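/- Let $C(\mathbb R^d)$ be the space of non-negative continuous functions on $\mathbb R^d$ with the topology of uniform convergence on compact sets. Let $\sum_{i\in\mathbb N}\delta_{U_i}$ be a Poisson point process on $(0,\infty)$ with intensity $u^{-2}\,du$, and let $W_i$, $i\in\mathbb N$, be independent copies, independent of $(U_i)_i$, of a non-negative sample-continuous process $\{W(t): t\in\mathbb R^d\}$ such that $\lim_{\|t\|\to\infty}W(t)=0$ a.s., $\mathbb E W(t)=1$ for all $t\in\mathbb R^d$, and $\mathbb E\max_{t\in K}W(t)<\infty$ for every compact $K\subset\mathbb R^d$. Let $W$ be Brown–Resnick stationary, i.e. the process $\xi(t)=\max_{i\in\mathbb N}U_iW_i(t)$, $t\in\mathbb R^d$, is stationary with standard Fréchet margins, $\mathbb P(\xi(t)\le x)=e^{-1/x}$ for $x>0$. Put $\gamma_i=\sup_{t}W_i(t)$ and $\tau_i=\inf\{\operatorname{arg\,sup}_t W_i(t)\}$, the infimum being taken in the lexicographic order, and define $\gamma,\tau$ in the same way from $W$. Then: 1. The random variables $\gamma_i$ and $\tau_i$ are well-defined: almost surely $\gamma_i<\infty$, and, if $\gamma_i>0$, the set of maximisers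 of $W_i$ is non-empty and contains its lexicographic minimum $\tau_i$. There are a constant $c\in(0,\infty)$ and a probability measure $\mathbb P_{\tilde F}$ on $C(\mathbb R^d)$ such that $$\sum_{i\in\mathbb N:\ \gamma_i>0}\delta_{\left(U_i\gamma_i,\ \tau_i,\ W_i(\cdot+\tau_i)/\gamma_i\right)}$$ is a Poisson point process on $(0,\infty)\times\mathbb R^d\times C(\mathbb R^d)$ with intensity measure $c\,u^{-2}\,du\,dt\,\mathbb P_{\tilde F}(df)$. (If $W$ is a.s. not identically zero, then a.s. no index is discarded.) 2. Let $\mathbb P_F$ be the law of $F=c\tilde F$, where $\tilde F$ has law $\mathbb P_{\tilde F}$. Then $\xi$ has a mixed moving maxima representation with shape function $F$: one has $\mathbb E\int_{\mathbb R^d}F(t)\,dt=1$, and there is a Poisson point process $\Phi$ on $(0,\infty)\times\mathbb R^d\times C(\mathbb R^d)$ with intensity $u^{-2}\,du\,dt\,\mathbb P_F(df)$ such that, almost surely, $\xi(t)=\max_{(u,s,f)\in\Phi}u f(t-s)$ for all $t\in\mathbb R^d$. Moreover, for the same $c$ and $\mathbb P_{\tilde F}$ as in 1, $$c=\left(\int_{\mathbb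 R^d}\int_{C(\mathbb R^d)}f(t)\,\mathbb P_{\tilde F}(df)\,dt\right)^{-1},$$ and, for every Borel set $A\subset C(\mathbb R^d)$ and every compact $K\subset\mathbb R^d$ with positive Lebesgue measure, $$\mathbb P_{\tilde F}(A)=\frac{\int_0^\infty y\,\mathbb P\bigl(W(\cdot+\tau)/y\in A,\ \tau\in K\mid\gamma=y\bigr)\,\mathbb P_\gamma(dy)}{\int_0^\infty y\,\mathbb P\bigl(\tau\in K\mid\gamma=y\bigr)\,\mathbb P_\gamma(dy)},$$ where $\mathbb P_\gamma$ is the law of $\gamma$ and the denominator is positive and finite. -/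

import Mathlib

open MeasureTheory ProbabilityTheory Topology
open scoped NNReal ENNReal

/-- The space `C(ℝ^d)` of non-negative continuous functions on `ℝ^d`, with the topology of uniform
convergence on compact sets (the compact-open topology). -/
abbrev PathSpace (d : ℕ) : Type := C(EuclideanSpace ℝ (Fin d), ℝ≥0)

instance PathSpace.measurableSpace (d : ℕ) : MeasurableSpace (PathSpace d) := borel _

instance PathSpace.borelSpace (d : ℕ) : BorelSpace (PathSpace d) := ⟨rfl⟩

/-! ### Poisson point processes -/

/-- `m` is the counting measure of a countable family of points (with multiplicities). -/
def IsPointMeasure {S : Type*} [MeasurableSpace S] (m : Measure S) : Prop :=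
  ∃ (ι : Type) (_ : Countable ι) (x : ι → S), m = Measure.sum fun i => Measure.dirac (x i)

/-- The random measure `N` on `S` is a Poisson point process with intensity measure `μ`: it is
almost surely a point measure, `N(B)` is a random variable which is Poisson distributed with
parameter `μ B` (almost surely infinite if `μ B = ∞`) for every measurable set `B`, and the numbers
of points in finitely many pairwise disjoint measurable sets are independent. -/
structure IsPoissonPointProcess {Ω S : Type*} [MeasurableSpace Ω] [MeasurableSpace S]
    (P : Measure Ω) (N : Ω → Measure S) (μ : Measure S) : Prop where
  pointMeasure : ∀ᵐ ω ∂P, IsPointMeasure (N ω)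
  aemeasurable : ∀ B : Set S, MeasurableSet B → AEMeasurable (fun ω => N ω B) P
  law_of_ne_top : ∀ B : Set S, MeasurableSet B → μ B ≠ ∞ →
    P.map (fun ω => N ω B) =
      (poissonMeasure (μ B).toNNReal).map (fun n : ℕ => (n : ℝ≥0∞))
  law_of_eq_top : ∀ B : Set S, MeasurableSet B → μ B = ∞ → ∀ᵐ ω ∂P, N ω B = ∞
  indep : ∀ (n : ℕ) (B : Fin n → Set S), (∀ j, MeasurableSet (B j)) →
    Pairwise (fun j k => Disjoint (B j) (B k)) →
    iIndepFun (fun j ω => N ω (B j)) P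

/-- The measure `u⁻² du` on `(0, ∞)`, as a measure on `ℝ` carried by `(0, ∞)`. -/
noncomputable def frechetIntensity : Measure ℝ :=
  (volume.restrict (Set.Ioi 0)).withDensity fun u => ENNReal.ofReal ((u ^ 2)⁻¹)

/-- `∑ i, δ_{U i}` is a Fréchet point process: Poisson on `(0, ∞)` with intensity `u⁻² du`. -/
def IsFrechetPointProcess {Ω : Type*} [MeasurableSpace Ω] (P : Measure Ω) (U : ℕ → Ω → ℝ) : Prop :=
  IsPoissonPointProcess P (fun ω => Measure.sum fun i => Measure.dirac (U i ω)) frechetIntensity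

/-! ### Maxima, first argmax, normalised profile -/

/-- `γ(f) = sup_t f(t)`; it is the true supremum as soon as `f` is bounded. -/
noncomputable def pathSup {d : ℕ} (f : PathSpace d) : ℝ≥0 := ⨆ t, f t

/-- `t` is the lexicographic minimum of `argsup f`. -/
def IsFirstArgmax {d : ℕ} (f : PathSpace d) (t : EuclideanSpace ℝ (Fin d)) : Prop :=
  (∀ r, f r ≤ f t) ∧ ∀ s, (∀ r, f r ≤ f s) → toLex t.ofLp ≤ toLex s.ofLp

open Classical in
/-- `τ(f) = inf argsup f`, the infimum in the lexicographic sense (`0` if there is no first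
maximiser). -/
noncomputable def firstArgmax {d : ℕ} (f : PathSpace d) : EuclideanSpace ℝ (Fin d) :=
  if h : ∃ t, IsFirstArgmax f t then h.choose else 0

/-- The shifted function `f(· + s)`. -/
def shiftPath {d : ℕ} (s : EuclideanSpace ℝ (Fin d)) (f : PathSpace d) : PathSpace d :=
  ⟨fun t => f (t + s), by fun_prop⟩

/-- The function `f(· + τ(f)) / y`. -/
noncomputable def centredPath {d : ℕ} (y : ℝ≥0) (f : PathSpace d) : PathSpace d :=
  y⁻¹ • shiftPath (firstArgmax f) f

/-! ### Max-stable processes -/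

/-- `ξ(t) = max_i U_i W_i(t)`. -/
noncomputable def maxProcess {d : ℕ} {Ω : Type*} (U : ℕ → Ω → ℝ) (W : ℕ → Ω → PathSpace d)
    (t : EuclideanSpace ℝ (Fin d)) (ω : Ω) : ℝ≥0∞ :=
  ⨆ i, ENNReal.ofReal (U i ω) * (W i ω t : ℝ≥0∞)

/-- `ξ` is stationary: its finite-dimensional distributions are invariant under shifts. -/
def IsStationaryField {d : ℕ} {Ω : Type*} [MeasurableSpace Ω] (P : Measure Ω)
    (ξ : EuclideanSpace ℝ (Fin d) → Ω → ℝ≥0∞) : Prop :=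
  ∀ (h : EuclideanSpace ℝ (Fin d)) (n : ℕ) (t : Fin n → EuclideanSpace ℝ (Fin d)),
    P.map (fun ω j => ξ (t j + h) ω) = P.map (fun ω j => ξ (t j) ω)

/-- `ξ` has standard Fréchet margins: `P(ξ(t) ≤ x) = exp(-1/x)` for `x > 0`. -/
def HasStandardFrechetMargins {d : ℕ} {Ω : Type*} [MeasurableSpace Ω] (P : Measure Ω)
    (ξ : EuclideanSpace ℝ (Fin d) → Ω → ℝ≥0∞) : Prop :=
  ∀ (t : EuclideanSpace ℝ (Fin d)) (x : ℝ), 0 < x →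
    P {ω | ξ t ω ≤ ENNReal.ofReal x} = ENNReal.ofReal (Real.exp (-1 / x))

/-- The intensity `c u⁻² du dt Q(df)` on `(0, ∞) × ℝ^d × C(ℝ^d)`. -/
noncomputable def m3Intensity {d : ℕ} (c : ℝ≥0) (Q : Measure (PathSpace d)) :
    Measure (ℝ × EuclideanSpace ℝ (Fin d) × PathSpace d) :=
  (c : ℝ≥0∞) • frechetIntensity.prod ((volume : Measure (EuclideanSpace ℝ (Fin d))).prod Q)

/-- `ξ` has a mixed moving maxima representation with shape function distributed as `Q`: the
expected integral of the shape function is `1`, and for some Poisson point process `N` on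
`(0, ∞) × ℝ^d × C(ℝ^d)` with intensity `u⁻² du dt Q(df)`, almost surely, for all `t`, the value
`ξ(t)` is the maximum of `u f(t - s)` over the points `(u, s, f)` of `N`. -/
def HasM3Representation {d : ℕ} {Ω : Type*} [MeasurableSpace Ω] (P : Measure Ω)
    (ξ : EuclideanSpace ℝ (Fin d) → Ω → ℝ≥0∞) (Q : Measure (PathSpace d)) : Prop :=
  IsProbabilityMeasure Q ∧
  ∫⁻ f, ∫⁻ t, (f t : ℝ≥0∞) ∂(volume : Measure (EuclideanSpace ℝ (Fin d))) ∂Q = 1 ∧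
  ∃ N : Ω → Measure (ℝ × EuclideanSpace ℝ (Fin d) × PathSpace d),
    IsPoissonPointProcess P N (m3Intensity 1 Q) ∧
    ∀ᵐ ω ∂P, ∀ t, ξ t ω =
      ⨆ p ∈ {p : ℝ × EuclideanSpace ℝ (Fin d) × PathSpace d | N ω {p} ≠ 0},
        ENNReal.ofReal p.1 * (p.2.2 (t - p.2.1) : ℝ≥0∞)

/-- The point process `∑ i, δ_{(U_i γ_i, τ_i, W_i(· + τ_i) / γ_i)}` on `(0, ∞) × ℝ^d × C(ℝ^d)`.
Indices with `γ_i = 0`, that is with `W_i` identically zero, give no point of this space; the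
restriction discards them. -/
noncomputable def centredPointProcess {d : ℕ} {Ω : Type*} (U : ℕ → Ω → ℝ)
    (W : ℕ → Ω → PathSpace d) (ω : Ω) :
    Measure (ℝ × EuclideanSpace ℝ (Fin d) × PathSpace d) :=
  (Measure.sum fun i => Measure.dirac
    (U i ω * (pathSup (W i ω) : ℝ), firstArgmax (W i ω),
      centredPath (pathSup (W i ω)) (W i ω))).restrict {p | 0 < p.1}

/-- `∫ y P(W(· + τ) / y ∈ A, τ ∈ K | γ = y) P_γ(dy)` over `(0, ∞)`, where `τ`, `γ` are the first
argmax and the supremum of `W`. -/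
noncomputable def tiltedProb {d : ℕ} {Ω : Type*} [MeasurableSpace Ω] (P : Measure Ω)
    [IsProbabilityMeasure P] (W : Ω → PathSpace d) (A : Set (PathSpace d))
    (K : Set (EuclideanSpace ℝ (Fin d))) : ℝ≥0∞ :=
  ∫⁻ y, (y : ℝ≥0∞) *
      condDistrib W (fun ω => pathSup (W ω)) P y {f | centredPath y f ∈ A ∧ firstArgmax f ∈ K}
    ∂(P.map fun ω => pathSup (W ω))

/-! Write `p` for the law of `W`. By the marking theorem, the points `(U_i, W_i)` form a Poisson
process with intensity `u⁻² du × p`. Centring is a measurable map of these points. For a fixed path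
it dilates `u` by `γ`, which multiplies `u⁻² du` by `γ`. The centred process is therefore Poisson
with intensity `u⁻² du × ν`, where `ν` is the law of `(τ, W(· + τ)/γ)` weighted by `γ`
(`profileMeasure`, `map_centredMap_restrict`). It remains to see that `ν` has the form `c dt × Q`.

This is where stationarity enters. Let `Λ` be the image of `u⁻² du × p` under `(u, f) ↦ u f`. The
void probabilities of the Poisson process give `P(ξ(t_j) ≤ x_j for all j) = exp(-Λ{f : f(t_j) > x_j
for some j})`, so the finite-dimensional laws of `ξ` determine `Λ` off the zero path, and
stationarity makes `Λ` shift invariant there (`exponentMeasure_shift_eq`). The set of paths with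
supremum above `1` and profile in `B` has `Λ`-mass `ν(B)`, so `ν` is invariant under translations of
its first coordinate (`profileMeasure_translate`). It is finite over compacts because `E max_K W <
∞`. Uniqueness of Haar measure then gives `ν = dt × ρ` (`exists_eq_prod_of_translate`); `c` is the
mass of `ρ`, and `E W(0) = 1` becomes `c ∫∫ f = 1` (`exists_shape_law`).

The moving maxima representation follows by mapping `(u, s, f)` to `(u/c, s, c f)`, which leaves
every product `u f(t - s)` unchanged. The formula for `Q` holds because its numerator is `ν(K × A) =
c |K| Q(A)`. Marking is proved through Laplace functionals, which characterise Poisson processes;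
values in `[0, ∞]` are kept throughout, since intensities may be infinite. -/

/-! ### The function `exp (-x)` on `[0, ∞]` -/

/-- The decreasing bijection `x ↦ exp (-x)` from `[0, ∞]` to `[0, 1]`. -/
noncomputable def expNeg (x : ℝ≥0∞) : ℝ≥0∞ := EReal.exp (-(x : EReal))

/-- The inverse `y ↦ -log y` of `expNeg`. -/
noncomputable def negLog (y : ℝ≥0∞) : ℝ≥0∞ := (-ENNReal.log y).toENNReal

@[simp] lemma expNeg_zero : expNeg 0 = 1 := by simp [expNeg]

@[simp] lemma expNeg_top : expNeg ∞ = 0 := by simp [expNeg]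

lemma expNeg_eq_inv (x : ℝ≥0∞) : expNeg x = (EReal.exp x)⁻¹ := EReal.exp_neg _

lemma expNeg_le_one (x : ℝ≥0∞) : expNeg x ≤ 1 := by
  rw [expNeg_eq_inv, ENNReal.inv_le_one]
  simpa using EReal.coe_ennreal_nonneg x

lemma expNeg_ne_top (x : ℝ≥0∞) : expNeg x ≠ ∞ :=
  ((expNeg_le_one x).trans_lt ENNReal.one_lt_top).ne

lemma antitone_expNeg : Antitone expNeg := fun x y h => by
  simpa [expNeg] using h

lemma continuous_expNeg : Continuous expNeg :=
  ENNReal.continuous_exp.comp (continuous_neg.comp continuous_coe_ennreal_ereal)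

@[fun_prop] lemma measurable_expNeg : Measurable expNeg := continuous_expNeg.measurable

@[fun_prop] lemma measurable_negLog : Measurable negLog := by
  unfold negLog
  fun_prop

lemma negLog_expNeg (x : ℝ≥0∞) : negLog (expNeg x) = x := by
  simp [negLog, expNeg]

lemma expNeg_negLog {y : ℝ≥0∞} (hy : y ≤ 1) : expNeg (negLog y) = y := by
  have : 0 ≤ -ENNReal.log y := by
    rw [EReal.neg_nonneg]
    simpa using hy
  rw [negLog, expNeg, EReal.coe_toENNReal this, neg_neg, ENNReal.exp_log]

lemma expNeg_add (x y : ℝ≥0∞) : expNeg (x + y) = expNeg x * expNeg y := by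
  simp only [expNeg_eq_inv, EReal.coe_ennreal_add, EReal.exp_add]
  rw [ENNReal.mul_inv]
  · left; simp
  · right; simp

lemma expNeg_sum {ι : Type*} (s : Finset ι) (x : ι → ℝ≥0∞) :
    expNeg (∑ i ∈ s, x i) = ∏ i ∈ s, expNeg (x i) := by
  classical
  induction s using Finset.induction_on with
  | empty => simp
  | insert a s ha ih => rw [Finset.sum_insert ha, Finset.prod_insert ha, expNeg_add, ih]

lemma expNeg_mul_natCast (x : ℝ≥0∞) (n : ℕ) : expNeg (x * n) = expNeg x ^ n := by
  induction n with
  | zero => simp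
  | succ n ih => rw [Nat.cast_succ, mul_add, expNeg_add, ih, mul_one, pow_succ]

lemma expNeg_ofReal {r : ℝ} (hr : 0 ≤ r) :
    expNeg (ENNReal.ofReal r) = ENNReal.ofReal (Real.exp (-r)) := by
  rw [expNeg, EReal.coe_ennreal_ofReal, max_eq_left hr, ← EReal.coe_neg, EReal.exp_coe]

lemma expNeg_eq_zero {x : ℝ≥0∞} : expNeg x = 0 ↔ x = ∞ := by
  refine ⟨fun h => ?_, fun h => by simp [h]⟩
  rw [← negLog_expNeg x, h]; simp [negLog]

lemma expNeg_tsum {x : ℕ → ℝ≥0∞} :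
    Filter.Tendsto (fun n => ∏ i ∈ Finset.range n, expNeg (x i)) Filter.atTop
      (𝓝 (expNeg (∑' i, x i))) := by
  simp_rw [← expNeg_sum]
  exact (continuous_expNeg.tendsto _).comp ENNReal.summable.hasSum.tendsto_sum_nat

/-! ### Determination of laws on `[0, ∞]^n` by Laplace transforms -/

/-- Probability measures on a finite-dimensional cube are determined by their moments. -/
lemma unitCube_measure_ext {ι : Type*} [Fintype ι] {μ ν : Measure (ι → unitInterval)}
    [IsProbabilityMeasure μ] [IsProbabilityMeasure ν]
    (h : ∀ k : ι → ℕ, ∫ x, ∏ i, (x i : ℝ) ^ k i ∂μ = ∫ x, ∏ i, (x i : ℝ) ^ k i ∂ν) : μ = ν := by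
  -- Polynomials in the coordinates form a point-separating algebra, and their integrals are finite
  -- linear combinations of moments.
  let e : ι → BoundedContinuousFunction (ι → unitInterval) ℝ := fun i =>
    BoundedContinuousFunction.mkOfCompact ⟨fun x => (x i : ℝ), by fun_prop⟩
  let φ := MvPolynomial.aeval (R := ℝ) e
  let A : StarSubalgebra ℝ (BoundedContinuousFunction (ι → unitInterval) ℝ) :=
    { φ.range with
      star_mem' := fun {a} ha => by
        have : star a = a := by ext x; simp
        rw [this]; exact ha }
  have hint : ∀ (ρ : Measure (ι → unitInterval)) [IsProbabilityMeasure ρ] (p : MvPolynomial ι ℝ),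
      ∫ x, φ p x ∂ρ = ∑ k ∈ p.support, p.coeff k * ∫ x, ∏ i, (x i : ℝ) ^ k i ∂ρ := by
    intro ρ _ p
    have : ∀ x, φ p x = ∑ k ∈ p.support, p.coeff k * ∏ i, (x i : ℝ) ^ k i := by
      intro x
      simp only [φ, MvPolynomial.aeval_eq_eval₂Hom, MvPolynomial.coe_eval₂Hom, MvPolynomial.eval₂_eq']
      rw [BoundedContinuousFunction.coe_sum, Finset.sum_apply]
      refine Finset.sum_congr rfl fun k _ => ?_
      rw [BoundedContinuousFunction.mul_apply]
      congr 1
      · have : (∏ i, e i ^ k i) x = ∏ i, (e i x) ^ k i := by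
          rw [BoundedContinuousFunction.coe_prod, Finset.prod_apply]
          simp
        exact this
    simp_rw [this]
    rw [integral_finsetSum]
    · simp_rw [integral_const_mul]
    · intro k _
      refine Integrable.const_mul ?_ _
      refine Continuous.integrable_of_hasCompactSupport (by fun_prop) (HasCompactSupport.of_compactSpace _)
  refine ext_of_forall_mem_subalgebra_integral_eq_of_polish (𝕜 := ℝ) (A := A) ?_ ?_
  · intro x y hxy
    obtain ⟨i, hi⟩ := Function.ne_iff.1 hxy
    refine ⟨e i, ⟨_, ⟨e i, ⟨MvPolynomial.X i, by simp [φ]⟩, rfl⟩, rfl⟩, ?_⟩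
    simpa [e, Subtype.ext_iff] using hi
  · rintro g ⟨p, rfl⟩
    change ∫ x, φ p x ∂μ = ∫ x, φ p x ∂ν
    rw [hint μ, hint ν]
    simp_rw [h]

/-- Probability measures on `[0, ∞]^n` are determined by their Laplace transforms at integer
points. -/
lemma measure_ext_of_lintegral_expNeg {ι : Type*} [Fintype ι] {μ ν : Measure (ι → ℝ≥0∞)}
    [IsProbabilityMeasure μ] [IsProbabilityMeasure ν]
    (h : ∀ k : ι → ℕ, ∫⁻ x, expNeg (∑ i, x i * k i) ∂μ = ∫⁻ x, expNeg (∑ i, x i * k i) ∂ν) :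
    μ = ν := by
  -- Under `x ↦ exp(-x)` in each coordinate, Laplace transforms at integer vectors become moments on
  -- the cube. The left inverse `Ψ` carries the equality of image laws back.
  let Φ : (ι → ℝ≥0∞) → ι → unitInterval := fun x i =>
    ⟨(expNeg (x i)).toReal, ENNReal.toReal_nonneg, ENNReal.toReal_le_of_le_ofReal zero_le_one
      (by simpa using expNeg_le_one (x i))⟩
  let Ψ : (ι → unitInterval) → ι → ℝ≥0∞ := fun y i => negLog (ENNReal.ofReal (y i))
  have hΦ : Measurable Φ := by
    refine measurable_pi_lambda _ fun i => Measurable.subtype_mk ?_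
    exact (measurable_expNeg.comp (measurable_pi_apply i)).ennreal_toReal
  have hΨ : Measurable Ψ := by fun_prop
  have hΨΦ : Ψ ∘ Φ = id := by
    ext x i
    simp [Ψ, Φ, ENNReal.ofReal_toReal (expNeg_ne_top _), negLog_expNeg]
  have hint : ∀ (ρ : Measure (ι → ℝ≥0∞)) [IsProbabilityMeasure ρ] (k : ι → ℕ),
      ∫ x, ∏ i, (x i : ℝ) ^ k i ∂(ρ.map Φ) = (∫⁻ x, expNeg (∑ i, x i * k i) ∂ρ).toReal := by
    intro ρ _ k
    have hm : Measurable fun x : ι → ℝ≥0∞ => expNeg (∑ i, x i * k i) := by fun_prop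
    rw [integral_map hΦ.aemeasurable (Continuous.aestronglyMeasurable (by fun_prop))]
    rw [← integral_toReal hm.aemeasurable (ae_of_all _ fun x => (expNeg_ne_top _).lt_top)]
    refine integral_congr_ae (ae_of_all _ fun x => ?_)
    simp [Φ, expNeg_sum, expNeg_mul_natCast, ENNReal.toReal_prod]
  have : IsProbabilityMeasure (μ.map Φ) := Measure.isProbabilityMeasure_map hΦ.aemeasurable
  have : IsProbabilityMeasure (ν.map Φ) := Measure.isProbabilityMeasure_map hΦ.aemeasurable
  have key : μ.map Φ = ν.map Φ := unitCube_measure_ext fun k => by rw [hint μ, hint ν, h]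
  have := congrArg (Measure.map Ψ) key
  rwa [Measure.map_map hΨ hΦ, Measure.map_map hΨ hΦ, hΨΦ, Measure.map_id, Measure.map_id] at this

/-- The Laplace transform of the Poisson distribution. -/
lemma lintegral_expNeg_poissonMeasure (r : ℝ≥0) (a : ℝ≥0∞) :
    ∫⁻ n : ℕ, expNeg (a * n) ∂(poissonMeasure r) = expNeg ((1 - expNeg a) * r) := by
  obtain ⟨s, hs⟩ : ∃ s : ℝ≥0, (s : ℝ≥0∞) = expNeg a := ⟨_, ENNReal.coe_toNNReal (expNeg_ne_top a)⟩
  have hs1 : s ≤ 1 := by have := expNeg_le_one a; rw [← hs] at this; exact_mod_cast this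
  have h1 : (1 - expNeg a) * r = ENNReal.ofReal ((1 - s) * r) := by
    rw [← hs, ← ENNReal.coe_one, ← ENNReal.coe_sub, ← ENNReal.coe_mul, ENNReal.ofReal,
      Real.toNNReal_mul (by simpa using hs1)]
    congr 2
    simp
  have hsum := ((NormedSpace.expSeries_div_hasSum_exp ((s : ℝ) * r)).mul_left (Real.exp (-r)))
  rw [h1, expNeg_ofReal (mul_nonneg (by simpa using hs1) r.coe_nonneg), poissonMeasure,
    lintegral_sum_measure]
  simp_rw [expNeg_mul_natCast, lintegral_smul_measure, lintegral_dirac, ← hs]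
  have : ∀ n : ℕ, ENNReal.ofReal (Real.exp (-r) * r ^ n / n.factorial) • (s : ℝ≥0∞) ^ n =
      ENNReal.ofReal (Real.exp (-r) * (((s : ℝ) * r) ^ n / n.factorial)) := by
    intro n
    rw [smul_eq_mul, ← ENNReal.coe_pow, ← ENNReal.ofReal_coe_nnreal, ← ENNReal.ofReal_mul (by positivity)]
    congr 1
    push_cast
    ring
  simp_rw [this]
  rw [← ENNReal.ofReal_tsum_of_nonneg (fun n => by positivity) hsum.summable, hsum.tsum_eq,
    ← Real.exp_eq_exp_ℝ, ← Real.exp_add]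
  congr 2
  ring

/-! ### Laplace functionals of Poisson point processes -/

lemma expNeg_lt_one {a : ℝ≥0∞} (ha : a ≠ 0) : expNeg a < 1 := by
  refine lt_of_le_of_ne (expNeg_le_one a) fun h => ha ?_
  rw [← negLog_expNeg a, h]; simp [negLog]

lemma lintegral_prod_of_iIndepFun {Ω ι : Type*} [MeasurableSpace Ω] {P : Measure Ω} [Fintype ι]
    {X : ι → Ω → ℝ≥0∞} (hX : iIndepFun X P) (hm : ∀ i, AEMeasurable (X i) P) :
    ∫⁻ ω, ∏ i, X i ω ∂P = ∏ i, ∫⁻ ω, X i ω ∂P := by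
  have h := lintegral_prod_eq_prod_lintegral_of_indepFun Finset.univ (fun i => (hm i).mk)
    (hX.congr fun i => (hm i).ae_eq_mk) (fun i => (hm i).measurable_mk)
  have h2 : ∀ i, ∫⁻ ω, (hm i).mk (X i) ω ∂P = ∫⁻ ω, X i ω ∂P := fun i =>
    lintegral_congr_ae (hm i).ae_eq_mk.symm
  simp_rw [h2] at h
  rw [← h]
  have h3 : ∀ᵐ ω ∂P, ∀ i, X i ω = (hm i).mk (X i) ω := ae_all_iff.2 fun i => (hm i).ae_eq_mk
  refine lintegral_congr_ae ?_
  filter_upwards [h3] with ω hω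
  simp_rw [hω]

section

variable {Ω S : Type*} [MeasurableSpace Ω] [MeasurableSpace S] {P : Measure Ω}
  [IsProbabilityMeasure P] {N : Ω → Measure S} {μ : Measure S}

lemma IsPoissonPointProcess.lintegral_expNeg_apply (hN : IsPoissonPointProcess P N μ)
    {B : Set S} (hB : MeasurableSet B) (a : ℝ≥0∞) :
    ∫⁻ ω, expNeg (a * N ω B) ∂P = expNeg ((1 - expNeg a) * μ B) := by
  by_cases h : μ B = ∞
  · have h1 : ∫⁻ ω, expNeg (a * N ω B) ∂P = ∫⁻ ω, expNeg (a * ∞) ∂P := by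
      refine lintegral_congr_ae ?_
      filter_upwards [hN.law_of_eq_top B hB h] with ω hω
      rw [hω]
    rw [h1, h]
    by_cases ha : a = 0
    · simp [ha]
    · have : 1 - expNeg a ≠ 0 := (tsub_pos_of_lt (expNeg_lt_one ha)).ne'
      simp [ENNReal.mul_top ha, ENNReal.mul_top this]
  · have hm : Measurable fun x : ℝ≥0∞ => expNeg (a * x) := by fun_prop
    rw [← lintegral_map' (f := fun x => expNeg (a * x)) hm.aemeasurable (hN.aemeasurable B hB),
      hN.law_of_ne_top B hB h, lintegral_map hm (by fun_prop), lintegral_expNeg_poissonMeasure,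
      ENNReal.coe_toNNReal h]

/-- The level sets of a simple function are disjoint, so their counts are independent and the
exponential of the integral splits into a product of one-set Laplace transforms. -/
lemma IsPoissonPointProcess.lintegral_expNeg_simpleFunc (hN : IsPoissonPointProcess P N μ)
    (f : SimpleFunc S ℝ≥0∞) :
    AEMeasurable (fun ω => expNeg (∫⁻ x, f x ∂N ω)) P ∧
    ∫⁻ ω, expNeg (∫⁻ x, f x ∂N ω) ∂P = expNeg (∫⁻ x, (1 - expNeg (f x)) ∂μ) := by
  let e := f.range.equivFin
  let B : Fin f.range.card → Set S := fun j => f ⁻¹' {(e.symm j : ℝ≥0∞)}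
  have hBm : ∀ j, MeasurableSet (B j) := fun j => f.measurableSet_fiber _
  have hBd : Pairwise fun j k => Disjoint (B j) (B k) := by
    intro j k hjk
    refine Disjoint.preimage _ ?_
    rw [Set.disjoint_singleton]
    exact fun h => hjk (e.symm.injective (Subtype.ext h))
  have hind := hN.indep _ B hBm hBd
  have hsum : ∀ (φ : ℝ≥0∞ → ℝ≥0∞) (ν : Measure S),
      ∫⁻ x, φ (f x) ∂ν = ∑ j, φ (e.symm j) * ν (B j) := by
    intro φ ν
    have h1 : ∫⁻ x, φ (f x) ∂ν = (f.map φ).lintegral ν := by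
      rw [← SimpleFunc.lintegral_eq_lintegral]; rfl
    rw [h1, SimpleFunc.map_lintegral, ← Finset.sum_coe_sort]
    exact (Equiv.sum_comp e.symm (fun x : f.range => φ x * ν (f ⁻¹' {(x : ℝ≥0∞)}))).symm
  have hprod : ∀ ω, expNeg (∫⁻ x, f x ∂N ω) = ∏ j, expNeg (e.symm j * N ω (B j)) := by
    intro ω
    rw [hsum (fun x => x), expNeg_sum]
  have hm : ∀ j, AEMeasurable (fun ω => expNeg (e.symm j * N ω (B j))) P := fun j =>
    measurable_expNeg.comp_aemeasurable ((hN.aemeasurable _ (hBm j)).const_mul _)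
  simp_rw [hprod]
  refine ⟨Finset.aemeasurable_fun_prod _ fun j _ => hm j, ?_⟩
  rw [hsum (fun x => 1 - expNeg x), expNeg_sum, lintegral_prod_of_iIndepFun _ hm]
  · exact Finset.prod_congr rfl fun j _ => hN.lintegral_expNeg_apply (hBm j) _
  · exact hind.comp (fun j x => expNeg (e.symm j * x)) (fun j => by fun_prop)

/-- The Laplace functional of a Poisson point process. -/
lemma IsPoissonPointProcess.lintegral_expNeg_lintegral (hN : IsPoissonPointProcess P N μ)
    {g : S → ℝ≥0∞} (hg : Measurable g) :
    ∫⁻ ω, expNeg (∫⁻ x, g x ∂N ω) ∂P = expNeg (∫⁻ x, (1 - expNeg (g x)) ∂μ) := by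
  let f := SimpleFunc.eapprox g
  have hmono : ∀ x, Monotone fun n => f n x := fun x m n h => SimpleFunc.monotone_eapprox g h x
  have hlim : ∀ x, Filter.Tendsto (fun n => f n x) Filter.atTop (𝓝 (g x)) :=
    SimpleFunc.tendsto_eapprox hg
  -- Both sides pass to the limit along increasing simple functions: the left by domination by `1`,
  -- the right by monotone convergence.
  have h1 : Filter.Tendsto (fun n => ∫⁻ ω, expNeg (∫⁻ x, f n x ∂N ω) ∂P) Filter.atTop
      (𝓝 (∫⁻ ω, expNeg (∫⁻ x, g x ∂N ω) ∂P)) := by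
    refine tendsto_lintegral_of_dominated_convergence' (fun _ => 1)
      (fun n => (hN.lintegral_expNeg_simpleFunc (f n)).1) (fun n => ae_of_all _ fun ω =>
        expNeg_le_one _) (by simp) (ae_of_all _ fun ω => ?_)
    refine (continuous_expNeg.tendsto _).comp ?_
    exact lintegral_tendsto_of_tendsto_of_monotone (fun n => (f n).measurable.aemeasurable)
      (ae_of_all _ hmono) (ae_of_all _ hlim)
  have h2 : Filter.Tendsto (fun n => expNeg (∫⁻ x, (1 - expNeg (f n x)) ∂μ)) Filter.atTop
      (𝓝 (expNeg (∫⁻ x, (1 - expNeg (g x)) ∂μ))) := by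
    refine (continuous_expNeg.tendsto _).comp ?_
    refine lintegral_tendsto_of_tendsto_of_monotone
      (fun n => (measurable_const.sub (measurable_expNeg.comp (f n).measurable)).aemeasurable)
      (ae_of_all _ fun x m n h => tsub_le_tsub_left (antitone_expNeg (hmono x h)) _)
      (ae_of_all _ fun x => ?_)
    exact ENNReal.Tendsto.sub tendsto_const_nhds ((continuous_expNeg.tendsto _).comp (hlim x))
      (Or.inl ENNReal.one_ne_top)
  simp_rw [(hN.lintegral_expNeg_simpleFunc _).2] at h1
  exact tendsto_nhds_unique h1 h2

/-- Void probabilities are the Laplace transform at `a = ∞`: since `∞ * 0 = 0`, the variable `exp(-∞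
· N(B))` is the indicator of `N(B) = 0`. -/
lemma IsPoissonPointProcess.measure_apply_eq_zero (hN : IsPoissonPointProcess P N μ)
    {B : Set S} (hB : MeasurableSet B) : P {ω | N ω B = 0} = expNeg (μ B) := by
  have h := hN.lintegral_expNeg_apply hB ∞
  have hm : NullMeasurableSet {ω | N ω B = 0} P :=
    (hN.aemeasurable B hB).nullMeasurable (measurableSet_singleton 0)
  rw [expNeg_top, tsub_zero, one_mul] at h
  rw [← h, ← lintegral_indicator_one₀ hm]
  refine lintegral_congr fun ω => ?_
  by_cases h0 : N ω B = 0
  · simp [h0]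
  · simp [h0, ENNReal.top_mul]

/-- A random point measure whose counts have the joint Laplace transforms of a Poisson point
process is a Poisson point process. -/
lemma isPoissonPointProcess_of_lintegral_expNeg (hpt : ∀ᵐ ω ∂P, IsPointMeasure (N ω))
    (hmeas : ∀ B : Set S, MeasurableSet B → AEMeasurable (fun ω => N ω B) P)
    (hL : ∀ g : S → ℝ≥0∞, Measurable g →
      ∫⁻ ω, expNeg (∫⁻ x, g x ∂N ω) ∂P = expNeg (∫⁻ x, (1 - expNeg (g x)) ∂μ)) :
    IsPoissonPointProcess P N μ := by
  have hL1 : ∀ (B : Set S), MeasurableSet B → ∀ a : ℝ≥0∞,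
      ∫⁻ ω, expNeg (N ω B * a) ∂P = expNeg ((1 - expNeg a) * μ B) := by
    intro B hB a
    have := hL (B.indicator fun _ => a) (measurable_const.indicator hB)
    simp_rw [lintegral_indicator_const hB, mul_comm a] at this
    rw [this, ← lintegral_indicator_const hB]
    congr 1
    refine lintegral_congr fun x => ?_
    by_cases hx : x ∈ B <;> simp [hx]
  refine ⟨hpt, hmeas, ?_, ?_, ?_⟩
  · intro B hB hfin
    -- A single count is treated as a vector indexed by `Unit`, so that the finite-dimensional
    -- uniqueness result applies.
    have hconst : Measurable fun x : ℝ≥0∞ => (fun _ : Unit => x) := by fun_prop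
    have hM := Measure.isProbabilityMeasure_map (hmeas B hB)
    have := Measure.isProbabilityMeasure_map (μ := P.map (fun ω => N ω B)) hconst.aemeasurable
    have := Measure.isProbabilityMeasure_map
      (μ := (poissonMeasure (μ B).toNNReal).map (fun n : ℕ => (n : ℝ≥0∞))) hconst.aemeasurable
    have key : (P.map (fun ω => N ω B)).map (fun x => (fun _ : Unit => x)) =
        ((poissonMeasure (μ B).toNNReal).map (fun n : ℕ => (n : ℝ≥0∞))).map
          (fun x => (fun _ : Unit => x)) := by
      refine measure_ext_of_lintegral_expNeg fun k => ?_
      have hm : Measurable fun x : Unit → ℝ≥0∞ => expNeg (∑ i, x i * k i) := by fun_prop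
      have hm' : Measurable fun x : ℝ≥0∞ => expNeg (x * k ()) := by fun_prop
      rw [lintegral_map hm hconst, lintegral_map hm hconst]
      simp only [Finset.univ_unique, PUnit.default_eq_unit, Finset.sum_singleton]
      rw [lintegral_map' hm'.aemeasurable (hmeas B hB), lintegral_map hm' (by fun_prop), hL1 B hB]
      simp_rw [mul_comm _ (k () : ℝ≥0∞)]
      rw [lintegral_expNeg_poissonMeasure, ENNReal.coe_toNNReal hfin]
    have := congrArg (Measure.map fun x : Unit → ℝ≥0∞ => x ()) key
    rwa [Measure.map_map (by fun_prop) hconst, Measure.map_map (by fun_prop) hconst,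
      show (fun x : Unit → ℝ≥0∞ => x ()) ∘ (fun x => (fun _ : Unit => x)) = id from rfl,
      Measure.map_id, Measure.map_id] at this
  · intro B hB htop
    -- The transform at `1` vanishes, so the non-negative variable `exp(-N(B))` is almost surely
    -- zero.
    have h := hL1 B hB 1
    rw [htop, ENNReal.mul_top (tsub_pos_of_lt (expNeg_lt_one one_ne_zero)).ne', expNeg_top,
      lintegral_eq_zero_iff' (f := fun ω => expNeg (N ω B * 1))
        (measurable_expNeg.comp_aemeasurable ((hmeas B hB).mul_const _))] at h
    filter_upwards [h] with ω hω
    simpa [expNeg_eq_zero] using hω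
  · intro n B hB hd
    rw [iIndepFun_iff_map_fun_eq_pi_map fun j => hmeas _ (hB j)]
    have hM : ∀ j, IsProbabilityMeasure (P.map fun ω => N ω (B j)) := fun j =>
      Measure.isProbabilityMeasure_map (hmeas _ (hB j))
    have hMM : AEMeasurable (fun ω j => N ω (B j)) P := aemeasurable_pi_lambda _ fun j => hmeas _ (hB j)
    have := Measure.isProbabilityMeasure_map hMM
    refine measure_ext_of_lintegral_expNeg fun k => ?_
    have hm : Measurable fun x : Fin n → ℝ≥0∞ => expNeg (∑ i, x i * k i) := by fun_prop
    rw [lintegral_map' hm.aemeasurable hMM]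
    have h1 : ∫⁻ ω, expNeg (∑ j, N ω (B j) * k j) ∂P =
        ∏ j, expNeg ((1 - expNeg (k j)) * μ (B j)) := by
      have hg : Measurable fun x => ∑ j, (B j).indicator (fun _ => (k j : ℝ≥0∞)) x :=
        Finset.measurable_fun_sum _ fun j _ => measurable_const.indicator (hB j)
      have h2 := hL _ hg
      -- At most one indicator is non-zero at `x`, so `1 - exp(-·)` is additive over these disjoint
      -- sets; this turns the joint transform into a product.
      have h3 : ∀ x, 1 - expNeg (∑ j, (B j).indicator (fun _ => (k j : ℝ≥0∞)) x) =
          ∑ j, (B j).indicator (fun _ => 1 - expNeg (k j)) x := by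
        intro x
        by_cases hx : ∃ j, x ∈ B j
        · obtain ⟨j, hj⟩ := hx
          have hne : ∀ i, i ≠ j → x ∉ B i := fun i hi hxi =>
            (Set.disjoint_left.1 (hd hi) hxi) hj
          rw [Finset.sum_eq_single j (fun i _ hi => by simp [hne i hi]) (by simp),
            Finset.sum_eq_single j (fun i _ hi => by simp [hne i hi]) (by simp)]
          simp [hj]
        · push Not at hx
          simp [hx]
      simp_rw [h3] at h2
      rw [lintegral_finsetSum _ fun j _ => measurable_const.indicator (hB j)] at h2
      simp_rw [lintegral_indicator_const (hB _)] at h2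
      rw [← expNeg_sum, ← h2]
      refine lintegral_congr fun ω => ?_
      rw [lintegral_finsetSum _ fun j _ => measurable_const.indicator (hB j)]
      simp_rw [lintegral_indicator_const (hB _), mul_comm]
    rw [h1]
    simp_rw [expNeg_sum]
    have hm1 : ∀ j, Measurable fun x : ℝ≥0∞ => expNeg (x * k j) := fun j => by fun_prop
    rw [lintegral_prod_of_iIndepFun (P := Measure.pi fun j => P.map fun ω => N ω (B j))
      (X := fun j x => expNeg (x j * k j)) (iIndepFun_pi fun j => (hm1 j).aemeasurable)
      (fun j => ((hm1 j).comp (measurable_pi_apply j)).aemeasurable)]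
    refine Finset.prod_congr rfl fun j _ => ?_
    rw [(measurePreserving_eval (fun j => P.map fun ω => N ω (B j)) j).lintegral_comp (hm1 j),
      lintegral_map' (hm1 j).aemeasurable (hmeas _ (hB j)), hL1 _ (hB j)]

end

/-! ### Restriction, mapping and marking of Poisson point processes -/

section

variable {Ω S E : Type*} [MeasurableSpace Ω] [MeasurableSpace S] [MeasurableSpace E]
  {P : Measure Ω}

lemma IsPointMeasure.restrict {m : Measure S} (hm : IsPointMeasure m) {A : Set S}
    (hA : MeasurableSet A) : IsPointMeasure (m.restrict A) := by
  classical
  obtain ⟨ι, _, x, rfl⟩ := hm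
  refine ⟨{i // x i ∈ A}, inferInstance, fun i => x i, ?_⟩
  ext B hB
  rw [Measure.restrict_apply hB, Measure.sum_apply _ (hB.inter hA), Measure.sum_apply _ hB]
  simp_rw [Measure.dirac_apply' _ (hB.inter hA), Measure.dirac_apply' _ hB]
  refine Eq.trans ?_ (tsum_subtype {i | x i ∈ A} fun i => B.indicator (1 : S → ℝ≥0∞) (x i)).symm
  refine tsum_congr fun i => ?_
  by_cases h : x i ∈ A <;> by_cases h' : x i ∈ B <;> simp [h, h']

lemma IsPointMeasure.map {m : Measure S} (hm : IsPointMeasure m) {T : S → E}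
    (hT : Measurable T) : IsPointMeasure (m.map T) := by
  obtain ⟨ι, _, x, rfl⟩ := hm
  refine ⟨ι, inferInstance, fun i => T (x i), ?_⟩
  rw [Measure.map_sum hT.aemeasurable]
  simp_rw [Measure.map_dirac' hT]

lemma IsPoissonPointProcess.restrict {N : Ω → Measure S} {μ : Measure S}
    (hN : IsPoissonPointProcess P N μ) {A : Set S} (hA : MeasurableSet A) :
    IsPoissonPointProcess P (fun ω => (N ω).restrict A) (μ.restrict A) where
  pointMeasure := hN.pointMeasure.mono fun _ h => h.restrict hA
  aemeasurable B hB := by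
    simp_rw [Measure.restrict_apply hB]
    exact hN.aemeasurable _ (hB.inter hA)
  law_of_ne_top B hB h := by
    simp_rw [Measure.restrict_apply hB]
    rw [Measure.restrict_apply hB] at h
    exact hN.law_of_ne_top _ (hB.inter hA) h
  law_of_eq_top B hB h := by
    simp_rw [Measure.restrict_apply hB]
    rw [Measure.restrict_apply hB] at h
    exact hN.law_of_eq_top _ (hB.inter hA) h
  indep n B hB hd := by
    have h : (fun j ω => ((N ω).restrict A) (B j)) = fun j ω => N ω (B j ∩ A) := by
      ext j ω; exact Measure.restrict_apply (hB j)
    rw [h]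
    exact hN.indep n (fun j => B j ∩ A) (fun j => (hB j).inter hA)
      fun j k h => (hd h).mono Set.inter_subset_left Set.inter_subset_left

lemma IsPoissonPointProcess.map {N : Ω → Measure S} {μ : Measure S}
    (hN : IsPoissonPointProcess P N μ) {T : S → E} (hT : Measurable T) :
    IsPoissonPointProcess P (fun ω => (N ω).map T) (μ.map T) where
  pointMeasure := hN.pointMeasure.mono fun _ h => h.map hT
  aemeasurable B hB := by
    simp_rw [Measure.map_apply hT hB]
    exact hN.aemeasurable _ (hT hB)
  law_of_ne_top B hB h := by
    simp_rw [Measure.map_apply hT hB]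
    rw [Measure.map_apply hT hB] at h
    exact hN.law_of_ne_top _ (hT hB) h
  law_of_eq_top B hB h := by
    simp_rw [Measure.map_apply hT hB]
    rw [Measure.map_apply hT hB] at h
    exact hN.law_of_eq_top _ (hT hB) h
  indep n B hB hd := by
    have h : (fun j ω => ((N ω).map T) (B j)) = fun j ω => N ω (T ⁻¹' B j) := by
      ext j ω; exact Measure.map_apply hT (hB j)
    rw [h]
    exact hN.indep n (fun j => T ⁻¹' B j) (fun j => hT (hB j)) fun j k h => (hd h).preimage T

variable [IsProbabilityMeasure P]

/-- Conditioning on `X`, the marks `Z i` may be integrated out one by one. -/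
lemma lintegral_prod_marks {X : ℕ → Ω → S} {Z : ℕ → Ω → E} {p : Measure E} [IsProbabilityMeasure p]
    (hX : ∀ i, Measurable (X i)) (hZ : ∀ i, Measurable (Z i)) (hZlaw : ∀ i, P.map (Z i) = p)
    (hZi : iIndepFun Z P) (hXZ : IndepFun (fun ω i => X i ω) (fun ω i => Z i ω) P)
    {e : S × E → ℝ≥0∞} (he : Measurable e) (n : ℕ) :
    ∫⁻ ω, ∏ i ∈ Finset.range n, e (X i ω, Z i ω) ∂P =
      ∫⁻ ω, ∏ i ∈ Finset.range n, ∫⁻ z, e (X i ω, z) ∂p ∂P := by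
  have hXm : Measurable fun ω i => X i ω := measurable_pi_lambda _ hX
  have hZm : Measurable fun ω i => Z i ω := measurable_pi_lambda _ hZ
  have hpX := Measure.isProbabilityMeasure_map (μ := P) hXm.aemeasurable
  have hpZ := Measure.isProbabilityMeasure_map (μ := P) hZm.aemeasurable
  have hlaw := (indepFun_iff_map_prod_eq_prod_map_map hXm.aemeasurable hZm.aemeasurable).1 hXZ
  let F : (ℕ → S) × (ℕ → E) → ℝ≥0∞ := fun q => ∏ i ∈ Finset.range n, e (q.1 i, q.2 i)
  have hF : Measurable F := by
    refine Finset.measurable_fun_prod _ fun i _ => he.comp ?_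
    fun_prop
  have hê : Measurable fun u => ∫⁻ z, e (u, z) ∂p := he.lintegral_prod_right'
  have hG : Measurable fun x : ℕ → S => ∏ i ∈ Finset.range n, ∫⁻ z, e (x i, z) ∂p :=
    Finset.measurable_fun_prod _ fun i _ => hê.comp (measurable_pi_apply i)
  have h1 : ∫⁻ ω, F (fun i => X i ω, fun i => Z i ω) ∂P =
      ∫⁻ x, ∫⁻ z, F (x, z) ∂(P.map fun ω i => Z i ω) ∂(P.map fun ω i => X i ω) := by
    rw [← lintegral_prod _ hF.aemeasurable, ← hlaw, lintegral_map hF (hXm.prodMk hZm)]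
  change ∫⁻ ω, F (fun i => X i ω, fun i => Z i ω) ∂P = _
  rw [h1]
  have h2 : ∀ x : ℕ → S, ∫⁻ z, F (x, z) ∂(P.map fun ω i => Z i ω) =
      ∏ i ∈ Finset.range n, ∫⁻ z, e (x i, z) ∂p := by
    intro x
    have hex : ∀ i, Measurable fun z => e (x i, z) := fun i => he.comp (by fun_prop)
    rw [lintegral_map (f := fun z => F (x, z)) (hF.comp measurable_prodMk_left) hZm]
    change ∫⁻ ω, ∏ i ∈ Finset.range n, e (x i, Z i ω) ∂P = _
    rw [lintegral_prod_eq_prod_lintegral_of_indepFun (Finset.range n)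
      (fun i ω => e (x i, Z i ω)) (hZi.comp (fun i z => e (x i, z)) hex)
      (fun i => (hex i).comp (hZ i))]
    refine Finset.prod_congr rfl fun i _ => ?_
    rw [← hZlaw i, lintegral_map (hex i) (hZ i)]
  simp_rw [h2]
  rw [lintegral_map hG hXm]

lemma lintegral_sum_dirac {g : S → ℝ≥0∞} (hg : Measurable g) (x : ℕ → S) :
    ∫⁻ y, g y ∂(Measure.sum fun i => Measure.dirac (x i)) = ∑' i, g (x i) := by
  rw [lintegral_sum_measure]
  simp_rw [lintegral_dirac' _ hg]

/-- The marking theorem. -/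
theorem IsPoissonPointProcess.marking {X : ℕ → Ω → S} {Z : ℕ → Ω → E} {μ : Measure S} [SFinite μ]
    {p : Measure E} [IsProbabilityMeasure p]
    (hN : IsPoissonPointProcess P (fun ω => Measure.sum fun i => Measure.dirac (X i ω)) μ)
    (hX : ∀ i, Measurable (X i)) (hZ : ∀ i, Measurable (Z i)) (hZlaw : ∀ i, P.map (Z i) = p)
    (hZi : iIndepFun Z P) (hXZ : IndepFun (fun ω i => X i ω) (fun ω i => Z i ω) P) :
    IsPoissonPointProcess P
      (fun ω => Measure.sum fun i => Measure.dirac (X i ω, Z i ω)) (μ.prod p) := by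
  refine isPoissonPointProcess_of_lintegral_expNeg
    (ae_of_all _ fun ω => ⟨ℕ, inferInstance, _, rfl⟩) (fun B hB => ?_) fun h hh => ?_
  · simp_rw [Measure.sum_apply _ hB, Measure.dirac_apply' _ hB]
    refine (Measurable.tsum fun i => ?_).aemeasurable
    exact (measurable_one.indicator hB).comp ((hX i).prodMk (hZ i))
  · have he : Measurable fun q => expNeg (h q) := measurable_expNeg.comp hh
    have hê : Measurable fun u => ∫⁻ z, expNeg (h (u, z)) ∂p := he.lintegral_prod_right'
    have hê1 : ∀ u, ∫⁻ z, expNeg (h (u, z)) ∂p ≤ 1 := fun u => by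
      calc ∫⁻ z, expNeg (h (u, z)) ∂p ≤ ∫⁻ _, 1 ∂p := lintegral_mono fun z => expNeg_le_one _
        _ = 1 := by simp
    have hlim : ∀ (a : ℕ → Ω → ℝ≥0∞), (∀ i, Measurable (a i)) →
        Filter.Tendsto (fun n => ∫⁻ ω, ∏ i ∈ Finset.range n, expNeg (a i ω) ∂P) Filter.atTop
          (𝓝 (∫⁻ ω, expNeg (∑' i, a i ω) ∂P)) := by
      intro a ha
      refine tendsto_lintegral_of_dominated_convergence (fun _ => 1)
        (fun n => Finset.measurable_fun_prod _ fun i _ => measurable_expNeg.comp (ha i))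
        (fun n => ae_of_all _ fun ω => ?_) (by simp) (ae_of_all _ fun ω => expNeg_tsum)
      exact Finset.prod_le_one' fun i _ => expNeg_le_one _
    have h1 := hlim (fun i ω => h (X i ω, Z i ω)) fun i => hh.comp ((hX i).prodMk (hZ i))
    -- The mark average lies in `[0, 1]`, hence equals `exp(-ℓ(u))` with `ℓ = negLog` of it. The
    -- partial products in `h1` and `h2` then coincide, and the marked functional becomes the
    -- Laplace functional of the unmarked process at `ℓ`.
    have hlog : Measurable fun u => negLog (∫⁻ z, expNeg (h (u, z)) ∂p) := by fun_prop
    have h2 := hlim (fun i ω => negLog (∫⁻ z, expNeg (h (X i ω, z)) ∂p)) fun i => hlog.comp (hX i)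
    simp_rw [lintegral_prod_marks hX hZ hZlaw hZi hXZ he] at h1
    simp_rw [expNeg_negLog (hê1 _)] at h2
    have h3 := hN.lintegral_expNeg_lintegral hlog
    simp_rw [lintegral_sum_dirac hlog, expNeg_negLog (hê1 _)] at h3
    simp_rw [lintegral_sum_dirac hh]
    rw [tendsto_nhds_unique h1 h2, h3,
      lintegral_prod (fun q => 1 - expNeg (h q)) (measurable_const.sub he).aemeasurable]
    congr 1
    refine lintegral_congr fun u => ?_
    rw [lintegral_sub (g := fun z => expNeg (h (u, z))) (he.comp measurable_prodMk_left)
      ((hê1 u).trans_lt ENNReal.one_lt_top).ne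
      (ae_of_all _ fun z => expNeg_le_one _)]
    simp

end

/-! ### Measurability on the path space -/

section

variable {d : ℕ}

@[fun_prop] lemma continuous_pathEval (t : EuclideanSpace ℝ (Fin d)) :
    Continuous fun f : PathSpace d => f t := by fun_prop

@[fun_prop] lemma measurable_pathEval (t : EuclideanSpace ℝ (Fin d)) :
    Measurable fun f : PathSpace d => f t := (continuous_pathEval t).measurable

lemma measurable_biSup_path (K : Set (EuclideanSpace ℝ (Fin d))) :
    Measurable fun f : PathSpace d => ⨆ t ∈ K, (f t : ℝ≥0∞) :=
  (lowerSemicontinuous_biSup fun t _ => (ENNReal.continuous_coe.comp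
    (continuous_pathEval t)).lowerSemicontinuous).measurable

lemma continuous_shiftPath :
    Continuous fun q : EuclideanSpace ℝ (Fin d) × PathSpace d => shiftPath q.1 q.2 := by
  refine ContinuousMap.continuous_of_continuous_uncurry _ ?_
  change Continuous fun q : (EuclideanSpace ℝ (Fin d) × PathSpace d) × EuclideanSpace ℝ (Fin d) =>
    q.1.2 (q.2 + q.1.1)
  fun_prop

lemma continuous_smulPath :
    Continuous fun q : ℝ≥0 × PathSpace d => q.1 • q.2 := by
  refine ContinuousMap.continuous_of_continuous_uncurry _ ?_
  change Continuous fun q : (ℝ≥0 × PathSpace d) × EuclideanSpace ℝ (Fin d) =>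
    q.1.1 * q.1.2 q.2
  fun_prop

lemma pathSup_eq_toNNReal (f : PathSpace d) : pathSup f = (⨆ t, (f t : ℝ≥0∞)).toNNReal := by
  rw [ENNReal.toNNReal_iSup fun _ => ENNReal.coe_ne_top]
  rfl

@[fun_prop] lemma measurable_pathSup : Measurable (pathSup : PathSpace d → ℝ≥0) := by
  have : (pathSup : PathSpace d → ℝ≥0) = fun f => (⨆ t ∈ Set.univ, (f t : ℝ≥0∞)).toNNReal := by
    ext f; simp [pathSup_eq_toNNReal]
  rw [this]
  exact (measurable_biSup_path _).ennreal_toNNReal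

/-! ### Measurable selection of the lexicographically first maximiser. -/

/-- The set of maximisers of `f` whose first `k` coordinates are lexicographically minimal. -/
def lexArgmax (f : PathSpace d) : ℕ → Set (EuclideanSpace ℝ (Fin d))
  | 0 => {t | ∀ r, f r ≤ f t}
  | k + 1 => {t ∈ lexArgmax f k | ∀ s ∈ lexArgmax f k, ∀ h : k < d, t ⟨k, h⟩ ≤ s ⟨k, h⟩}

lemma isClosed_lexArgmax (f : PathSpace d) (k : ℕ) : IsClosed (lexArgmax f k) := by
  induction k with
  | zero =>
    simp only [lexArgmax, Set.ofPred_forall]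
    exact isClosed_iInter fun r => isClosed_le continuous_const f.continuous
  | succ k ih =>
    have : lexArgmax f (k + 1) = lexArgmax f k ∩
        ⋂ s ∈ lexArgmax f k, ⋂ h : k < d, {t | t ⟨k, h⟩ ≤ s ⟨k, h⟩} := by
      ext t; simp [lexArgmax]
    rw [this]
    refine ih.inter (isClosed_biInter fun s _ => isClosed_iInter fun h => ?_)
    exact isClosed_le (by fun_prop) continuous_const

lemma lexArgmax_subset_zero (f : PathSpace d) (k : ℕ) : lexArgmax f k ⊆ lexArgmax f 0 := by
  induction k with
  | zero => exact le_rfl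
  | succ k ih => exact fun t ht => ih ht.1

/-- Links coordinate-by-coordinate minimisation, which suits measurability and compactness
arguments, with the lexicographic order: stage `k` compares only the first `k` coordinates, and `k =
d` is the full order. -/
lemma mem_lexArgmax_iff (f : PathSpace d) {k : ℕ} (hk : k ≤ d) (t : EuclideanSpace ℝ (Fin d)) :
    t ∈ lexArgmax f k ↔ t ∈ lexArgmax f 0 ∧ ∀ s ∈ lexArgmax f 0,
      (∀ j : Fin d, j.1 < k → t j = s j) ∨
        ∃ i : Fin d, i.1 < k ∧ (∀ j < i, t j = s j) ∧ t i < s i := by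
  induction k generalizing t with
  | zero => simp
  | succ k ih =>
    have hkd : k < d := hk
    replace ih := fun t => ih hkd.le t
    constructor
    · rintro ⟨htk, hmin⟩
      refine ⟨lexArgmax_subset_zero f k htk, fun s hs => ?_⟩
      rcases ((ih t).1 htk).2 s hs with h | ⟨i, hik, h⟩
      · have hsk : s ∈ lexArgmax f k := by
          refine (ih s).2 ⟨hs, fun r hr => ?_⟩
          rcases ((ih t).1 htk).2 r hr with h' | ⟨i, hik, h1, h2⟩
          · exact Or.inl fun j hj => (h j hj).symm.trans (h' j hj)
          · refine Or.inr ⟨i, hik, fun j hj => ?_, ?_⟩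
            · rw [← h j (lt_trans hj hik)]; exact h1 j hj
            · rw [← h i hik]; exact h2
        rcases (hmin s hsk hkd).lt_or_eq with h' | h'
        · exact Or.inr ⟨⟨k, hkd⟩, Nat.lt_succ_self k, fun j hj => h j hj, h'⟩
        · refine Or.inl fun j hj => ?_
          rcases Nat.lt_succ_iff_lt_or_eq.1 hj with hj | hj
          · exact h j hj
          · have : j = ⟨k, hkd⟩ := Fin.ext hj
            rw [this]; exact h'
      · exact Or.inr ⟨i, hik.trans (Nat.lt_succ_self k), h⟩
    · rintro ⟨ht0, h⟩
      have htk : t ∈ lexArgmax f k := by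
        refine (ih t).2 ⟨ht0, fun s hs => ?_⟩
        rcases h s hs with h' | ⟨i, hik, h1, h2⟩
        · exact Or.inl fun j hj => h' j (hj.trans (Nat.lt_succ_self k))
        · rcases Nat.lt_succ_iff_lt_or_eq.1 hik with hik | hik
          · exact Or.inr ⟨i, hik, h1, h2⟩
          · exact Or.inl fun j hj => h1 j (by rw [Fin.lt_def, hik]; exact hj)
      refine ⟨htk, fun s hs _ => ?_⟩
      rcases h s (lexArgmax_subset_zero f k hs) with h' | ⟨i, hik, h1, h2⟩
      · exact (h' _ (Nat.lt_succ_self k)).le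
      · rcases Nat.lt_succ_iff_lt_or_eq.1 hik with hik | hik
        · exfalso
          rcases ((ih s).1 hs).2 t ht0 with h3 | ⟨i', hi'k, h3, h4⟩
          · exact h2.ne' (h3 i hik)
          · rcases lt_trichotomy i i' with hlt | heq | hlt
            · exact h2.ne' (h3 i hlt)
            · subst heq; exact lt_asymm h2 h4
            · exact h4.ne' (h1 i' hlt)
        · have : (⟨k, hkd⟩ : Fin d) = i := Fin.ext hik.symm
          rw [this]; exact h2.le

lemma mem_lexArgmax_iff_isFirstArgmax (f : PathSpace d) (t : EuclideanSpace ℝ (Fin d)) :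
    t ∈ lexArgmax f d ↔ IsFirstArgmax f t := by
  rw [mem_lexArgmax_iff f le_rfl]
  refine and_congr Iff.rfl (forall₂_congr fun s _ => ?_)
  rw [le_iff_lt_or_eq, or_comm]
  refine or_congr ⟨?_, ?_⟩ ?_
  · rintro ⟨i, -, h⟩
    exact ⟨i, h⟩
  · rintro ⟨i, h⟩
    exact ⟨i, i.2, h⟩
  · rw [toLex_inj, funext_iff]
    exact forall_congr' fun j => by simp [j.2]

lemma IsFirstArgmax.unique {f : PathSpace d} {s t : EuclideanSpace ℝ (Fin d)}
    (hs : IsFirstArgmax f s) (ht : IsFirstArgmax f t) : s = t := by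
  have := toLex_inj.1 (le_antisymm (hs.2 t ht.1) (ht.2 s hs.1))
  exact WithLp.ofLp_injective 2 this

lemma IsFirstArgmax.firstArgmax_eq {f : PathSpace d} {t : EuclideanSpace ℝ (Fin d)}
    (ht : IsFirstArgmax f t) : firstArgmax f = t := by
  have h : ∃ t, IsFirstArgmax f t := ⟨t, ht⟩
  rw [firstArgmax, dif_pos h]
  exact h.choose_spec.unique ht

/-- Minimising a continuous function over random closed sets preserves measurability. -/
lemma measurableSet_inter_nonempty_of_minimizers {α : Type*} [MeasurableSpace α]
    {M : α → Set (EuclideanSpace ℝ (Fin d))} (hMc : ∀ a, IsClosed (M a))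
    (hM : ∀ C, IsClosed C → MeasurableSet {a | (M a ∩ C).Nonempty})
    {l : EuclideanSpace ℝ (Fin d) → ℝ} (hl : Continuous l)
    {C : Set (EuclideanSpace ℝ (Fin d))} (hC : IsClosed C) :
    MeasurableSet {a | ({t ∈ M a | ∀ s ∈ M a, l t ≤ l s} ∩ C).Nonempty} := by
  have hle : ∀ q : ℚ, IsClosed {t | l t ≤ q} := fun q => isClosed_le hl continuous_const
  -- A minimiser lies in `C` exactly when, inside some ball, `M a ∩ C` is non-empty and meets every
  -- rational sublevel set of `l` that `M a` meets. Compactness of the ball part supplies a minimum,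
  -- and density of `ℚ` shows that it is global.
  have key : {a | ({t ∈ M a | ∀ s ∈ M a, l t ≤ l s} ∩ C).Nonempty} =
      ⋃ n : ℕ, {a | (M a ∩ (C ∩ Metric.closedBall 0 n)).Nonempty} ∩ ⋂ q : ℚ,
        ({a | (M a ∩ {t | l t ≤ q}).Nonempty}ᶜ ∪
          {a | (M a ∩ (C ∩ Metric.closedBall 0 n ∩ {t | l t ≤ q})).Nonempty}) := by
    ext a
    simp only [Set.mem_iUnion, Set.mem_inter_iff, Set.mem_iInter, Set.mem_union, Set.mem_compl_iff]
    constructor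
    · rintro ⟨t, ⟨htM, hmin⟩, htC⟩
      obtain ⟨n, hn⟩ := exists_nat_ge ‖t‖
      have htn : t ∈ Metric.closedBall (0 : EuclideanSpace ℝ (Fin d)) n := by simpa using hn
      refine ⟨n, ⟨t, htM, htC, htn⟩, fun q => ?_⟩
      by_cases hq : (M a ∩ {t | l t ≤ q}).Nonempty
      · obtain ⟨s, hs, hsq⟩ := hq
        exact Or.inr ⟨t, htM, ⟨htC, htn⟩, (hmin s hs).trans hsq⟩
      · exact Or.inl hq
    · rintro ⟨n, hne, hq⟩
      have hcomp : IsCompact (M a ∩ (C ∩ Metric.closedBall 0 n)) := by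
        rw [← Set.inter_assoc]
        exact (isCompact_closedBall _ _).inter_left ((hMc a).inter hC)
      obtain ⟨t, ht, hmin⟩ := hcomp.exists_isMinOn hne hl.continuousOn
      refine ⟨t, ⟨ht.1, fun s hs => ?_⟩, ht.2.1⟩
      refine le_of_forall_gt fun x hx => ?_
      obtain ⟨q, hsq, hqx⟩ := exists_rat_btwn hx
      rcases hq q with h | ⟨r, hrM, hrC, hrq⟩
      · exact absurd ⟨s, hs, hsq.le⟩ h
      · exact ((hmin ⟨hrM, hrC⟩).trans hrq).trans_lt hqx
  rw [key]
  have hB : ∀ n : ℕ, IsClosed (C ∩ Metric.closedBall (0 : EuclideanSpace ℝ (Fin d)) n) := fun n =>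
    hC.inter Metric.isClosed_closedBall
  exact MeasurableSet.iUnion fun n => (hM _ (hB n)).inter <| MeasurableSet.iInter fun q =>
    (hM _ (hle q)).compl.union (hM _ ((hB n).inter (hle q)))

/-- The induction runs over all closed `C` at once, because minimising one more coordinate tests the
previous stage against balls and sublevel sets. -/
lemma measurableSet_lexArgmax_inter_nonempty (k : ℕ) (C : Set (EuclideanSpace ℝ (Fin d)))
    (hC : IsClosed C) : MeasurableSet {f : PathSpace d | (lexArgmax f k ∩ C).Nonempty} := by
  induction k generalizing C with
  | zero =>
    -- Non-emptiness must be imposed separately: the supremum over the empty set is `0`, which is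
    -- also the global supremum of the zero path.
    have key : {f : PathSpace d | (lexArgmax f 0 ∩ C).Nonempty} = ⋃ n : ℕ,
        {f | (C ∩ Metric.closedBall 0 n).Nonempty ∧ (⨆ t ∈ Set.univ, (f t : ℝ≥0∞)) ≤
          ⨆ t ∈ C ∩ Metric.closedBall 0 n, (f t : ℝ≥0∞)} := by
      ext f
      simp only [Set.mem_iUnion]
      constructor
      · rintro ⟨t, ht, htC⟩
        obtain ⟨n, hn⟩ := exists_nat_ge ‖t‖
        have htn : t ∈ Metric.closedBall (0 : EuclideanSpace ℝ (Fin d)) n := by simpa using hn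
        refine ⟨n, ⟨t, htC, htn⟩, iSup₂_le fun r _ => ?_⟩
        refine le_trans ?_ (le_iSup₂ (f := fun t (_ : t ∈ C ∩ Metric.closedBall 0 (n : ℝ)) =>
          (f t : ℝ≥0∞)) t ⟨htC, htn⟩)
        exact_mod_cast ht r
      · rintro ⟨n, hne, hle⟩
        have hcomp : IsCompact (C ∩ Metric.closedBall (0 : EuclideanSpace ℝ (Fin d)) n) :=
          (isCompact_closedBall _ _).inter_left hC
        obtain ⟨t, ht, hmax⟩ := hcomp.exists_isMaxOn hne f.continuous.continuousOn
        refine ⟨t, fun r => ?_, ht.1⟩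
        have h1 : (f r : ℝ≥0∞) ≤ ⨆ t ∈ Set.univ, (f t : ℝ≥0∞) :=
          le_iSup₂ (f := fun t (_ : t ∈ Set.univ) => (f t : ℝ≥0∞)) r trivial
        have h2 : (⨆ t ∈ C ∩ Metric.closedBall 0 (n : ℝ), (f t : ℝ≥0∞)) ≤ f t :=
          iSup₂_le fun s hs => by exact_mod_cast hmax hs
        exact_mod_cast (h1.trans hle).trans h2
    rw [key]
    exact MeasurableSet.iUnion fun n => (MeasurableSet.const _).inter
      (measurableSet_le (measurable_biSup_path _) (measurable_biSup_path _))
  | succ k ih =>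
    by_cases hk : k < d
    · have := measurableSet_inter_nonempty_of_minimizers
        (fun f : PathSpace d => isClosed_lexArgmax f k) ih
        (l := fun t => t ⟨k, hk⟩) (by fun_prop) hC
      simpa [lexArgmax, hk] using this
    · simpa [lexArgmax, hk] using ih C hC

@[fun_prop] lemma measurable_firstArgmax :
    Measurable (firstArgmax : PathSpace d → EuclideanSpace ℝ (Fin d)) := by
  refine measurable_of_isClosed fun C hC => ?_
  -- The second piece accounts for the default value `0` at paths without a first maximiser.
  have key : firstArgmax ⁻¹' C = {f : PathSpace d | (lexArgmax f d ∩ C).Nonempty} ∪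
      ({f | (lexArgmax f d ∩ Set.univ).Nonempty}ᶜ ∩
        {_f | (0 : EuclideanSpace ℝ (Fin d)) ∈ C}) := by
    ext f
    by_cases hf : ∃ t, IsFirstArgmax f t
    · obtain ⟨t, ht⟩ := hf
      have : lexArgmax f d = {t} := by
        ext s
        rw [mem_lexArgmax_iff_isFirstArgmax]
        exact ⟨fun hs => hs.unique ht, fun hs => hs ▸ ht⟩
      simp [this, ht.firstArgmax_eq]
    · have h0 : lexArgmax f d = ∅ := by
        ext s
        rw [mem_lexArgmax_iff_isFirstArgmax]
        exact ⟨fun hs => (hf ⟨s, hs⟩).elim, fun hs => hs.elim⟩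
      simp [h0, firstArgmax, hf]
  rw [key]
  exact (measurableSet_lexArgmax_inter_nonempty d C hC).union
    ((measurableSet_lexArgmax_inter_nonempty d _ isClosed_univ).compl.inter (MeasurableSet.const _))

lemma measurable_centredPath :
    Measurable fun q : ℝ≥0 × PathSpace d => centredPath q.1 q.2 := by
  have h1 : Measurable fun q : ℝ≥0 × PathSpace d => shiftPath (firstArgmax q.2) q.2 :=
    continuous_shiftPath.measurable.comp
      ((measurable_firstArgmax.comp measurable_snd).prodMk measurable_snd)
  exact continuous_smulPath.measurable.comp (measurable_fst.inv.prodMk h1)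

/-! ### Paths vanishing at infinity -/

/-- The set of paths vanishing at infinity. -/
def vanishingPaths (d : ℕ) : Set (PathSpace d) :=
  {f | Filter.Tendsto f (Bornology.cobounded (EuclideanSpace ℝ (Fin d))) (𝓝 0)}

lemma measurableSet_vanishingPaths : MeasurableSet (vanishingPaths d) := by
  have key : vanishingPaths d = ⋂ n : ℕ, ⋃ m : ℕ, ⋂ t : EuclideanSpace ℝ (Fin d),
      ⋂ _ : (m : ℝ) ≤ ‖t‖, {f | f t ≤ ((n : ℝ≥0) + 1)⁻¹} := by
    ext f
    simp only [vanishingPaths, Set.mem_iInter, Set.mem_iUnion, Set.mem_ofPred_eq]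
    have hb := nhds_bot_basis_Iic (α := ℝ≥0)
    rw [bot_eq_zero'] at hb
    rw [hb.tendsto_right_iff]
    constructor
    · intro h n
      have := h ((n : ℝ≥0) + 1)⁻¹ (by simp)
      obtain ⟨R, -, hR⟩ := (Filter.HasBasis.eventually_iff
        (Filter.HasBasis.cobounded_of_norm (E := EuclideanSpace ℝ (Fin d)) Filter.atTop_basis)).1 this
      obtain ⟨m, hm⟩ := exists_nat_ge R
      exact ⟨m, fun t ht => hR (hm.trans ht)⟩
    · intro h ε hε
      obtain ⟨n, hn⟩ := exists_nat_one_div_lt (K := ℝ≥0) hε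
      obtain ⟨m, hm⟩ := h n
      refine (Filter.HasBasis.eventually_iff
        (Filter.HasBasis.cobounded_of_norm (E := EuclideanSpace ℝ (Fin d)) Filter.atTop_basis)).2
        ⟨m, trivial, fun t ht => (hm t ht).trans ?_⟩
      rw [← one_div]; exact hn.le
  rw [key]
  refine MeasurableSet.iInter fun n => MeasurableSet.iUnion fun m => IsClosed.measurableSet ?_
  exact isClosed_iInter fun t => isClosed_iInter fun _ =>
    isClosed_le (continuous_pathEval t) continuous_const

lemma exists_max_of_mem_vanishingPaths {f : PathSpace d} (hf : f ∈ vanishingPaths d) :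
    ∃ t, ∀ r, f r ≤ f t := by
  by_cases h0 : ∃ t, 0 < f t
  · obtain ⟨t, ht⟩ := h0
    refine f.continuous.exists_forall_ge' t ?_
    rw [← Metric.cobounded_eq_cocompact]
    exact (hf.eventually (gt_mem_nhds ht)).mono fun _ h => h.le
  · push Not at h0
    exact ⟨0, fun r => (h0 r).trans zero_le⟩

lemma bddAbove_of_mem_vanishingPaths {f : PathSpace d} (hf : f ∈ vanishingPaths d) :
    BddAbove (Set.range f) := by
  obtain ⟨t, ht⟩ := exists_max_of_mem_vanishingPaths hf
  exact ⟨f t, by rintro _ ⟨r, rfl⟩; exact ht r⟩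

/-- A positive supremum confines the maximisers of a vanishing path to a bounded set, so they form a
compact set on which the coordinates can be minimised in turn. -/
lemma exists_isFirstArgmax {f : PathSpace d} (hf : f ∈ vanishingPaths d) (h0 : 0 < pathSup f) :
    ∃ t, IsFirstArgmax f t := by
  obtain ⟨t, ht⟩ := exists_max_of_mem_vanishingPaths hf
  have hft : 0 < f t := h0.trans_le (ciSup_le ht)
  have hcomp : IsCompact (lexArgmax f 0) := by
    refine Metric.isCompact_of_isClosed_isBounded (isClosed_lexArgmax f 0) ?_
    have : ∀ᶠ r in Bornology.cobounded (EuclideanSpace ℝ (Fin d)), f r < f t :=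
      hf.eventually (gt_mem_nhds hft)
    refine Bornology.IsBounded.subset (t := {r | f r < f t}ᶜ)
      (Bornology.isBounded_def.2 (by rwa [compl_compl])) ?_
    exact fun r hr => not_lt.2 (hr t)
  have hne : ∀ k, (lexArgmax f k).Nonempty := by
    intro k
    induction k with
    | zero => exact ⟨t, ht⟩
    | succ k ih =>
      by_cases hk : k < d
      · obtain ⟨s, hs, hmin⟩ := (hcomp.of_isClosed_subset (isClosed_lexArgmax f k)
          (lexArgmax_subset_zero f k)).exists_isMinOn ih
          (f := fun t => t ⟨k, hk⟩) (Continuous.continuousOn (by fun_prop))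
        exact ⟨s, hs, fun r hr _ => hmin hr⟩
      · obtain ⟨s, hs⟩ := ih
        exact ⟨s, hs, fun r hr h => (hk h).elim⟩
  obtain ⟨s, hs⟩ := hne d
  exact ⟨s, (mem_lexArgmax_iff_isFirstArgmax f s).1 hs⟩

lemma IsFirstArgmax.pathSup_eq {f : PathSpace d} {t : EuclideanSpace ℝ (Fin d)}
    (ht : IsFirstArgmax f t) : pathSup f = f t :=
  le_antisymm (ciSup_le ht.1) (le_ciSup (f := f) ⟨f t, by rintro _ ⟨r, rfl⟩; exact ht.1 r⟩ t)

/-! ### Shifts and multiples of paths -/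

@[simp] lemma shiftPath_apply (s t : EuclideanSpace ℝ (Fin d)) (f : PathSpace d) :
    shiftPath s f t = f (t + s) := rfl

lemma shiftPath_shiftPath (s t : EuclideanSpace ℝ (Fin d)) (f : PathSpace d) :
    shiftPath s (shiftPath t f) = shiftPath (s + t) f := by
  ext r; simp [add_assoc]

lemma pathSup_shiftPath (s : EuclideanSpace ℝ (Fin d)) (f : PathSpace d) :
    pathSup (shiftPath s f) = pathSup f :=
  (Equiv.addRight s).iSup_comp (g := fun t => f t)

lemma pathSup_smul (a : ℝ≥0) (f : PathSpace d) : pathSup (a • f) = a * pathSup f :=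
  (NNReal.mul_iSup (fun t => f t) a).symm

lemma IsFirstArgmax.smul {a : ℝ≥0} (ha : 0 < a) {f : PathSpace d} {t : EuclideanSpace ℝ (Fin d)}
    (ht : IsFirstArgmax f t) : IsFirstArgmax (a • f) t :=
  ⟨fun r => mul_le_mul_right (ht.1 r) a, fun s hs => ht.2 s fun r =>
    le_of_mul_le_mul_left (hs r : a * f r ≤ a * f s) ha⟩

lemma firstArgmax_smul {a : ℝ≥0} (ha : 0 < a) (f : PathSpace d) :
    firstArgmax (a • f) = firstArgmax f := by
  by_cases h : ∃ t, IsFirstArgmax f t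
  · obtain ⟨t, ht⟩ := h
    rw [ht.firstArgmax_eq, (ht.smul ha).firstArgmax_eq]
  · have h' : ¬ ∃ t, IsFirstArgmax (a • f) t := by
      rintro ⟨t, ht⟩
      refine h ⟨t, ?_⟩
      have := ht.smul (inv_pos.2 ha)
      rwa [inv_smul_smul₀ ha.ne'] at this
    rw [firstArgmax, firstArgmax, dif_neg h, dif_neg h']

/-- The lexicographic order is compatible with addition, so the first maximiser moves with the path.
-/
lemma IsFirstArgmax.shiftPath {f : PathSpace d} {t : EuclideanSpace ℝ (Fin d)}
    (ht : IsFirstArgmax f t) (h : EuclideanSpace ℝ (Fin d)) :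
    IsFirstArgmax (shiftPath h f) (t - h) := by
  refine ⟨fun r => by simpa using ht.1 (r + h), fun s hs => ?_⟩
  have h1 := ht.2 (s + h) fun r => by simpa using hs (r - h)
  have e1 : toLex (t - h).ofLp = toLex t.ofLp + toLex (-h).ofLp := by rw [sub_eq_add_neg]; rfl
  have e2 : toLex s.ofLp = toLex (s + h).ofLp + toLex (-h).ofLp := by
    rw [← toLex_add, ← WithLp.ofLp_add, add_neg_cancel_right]
  rw [e1, e2]
  exact add_le_add_left h1 _

lemma centredPath_smul {a : ℝ≥0} (ha : 0 < a) (y : ℝ≥0) (f : PathSpace d) :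
    centredPath (a * y) (a • f) = centredPath y f := by
  ext t
  simp only [centredPath, firstArgmax_smul ha, ContinuousMap.smul_apply, shiftPath_apply,
    smul_eq_mul, mul_inv]
  congr 1
  rw [mul_mul_mul_comm, inv_mul_cancel₀ ha.ne', one_mul]

lemma centredPath_shiftPath {f : PathSpace d} (hf : ∃ t, IsFirstArgmax f t) (y : ℝ≥0)
    (h : EuclideanSpace ℝ (Fin d)) : centredPath y (shiftPath h f) = centredPath y f := by
  obtain ⟨t, ht⟩ := hf
  rw [centredPath, centredPath, (ht.shiftPath h).firstArgmax_eq, ht.firstArgmax_eq,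
    shiftPath_shiftPath, sub_add_cancel]

end

/-! ### The Fréchet intensity -/

instance : SFinite frechetIntensity := by unfold frechetIntensity; infer_instance

lemma frechetIntensity_apply {A : Set ℝ} (hA : MeasurableSet A) :
    frechetIntensity A =
      ∫⁻ u, (A ∩ Set.Ioi 0).indicator (fun u => ENNReal.ofReal ((u ^ 2)⁻¹)) u := by
  rw [frechetIntensity, withDensity_apply _ hA, Measure.restrict_restrict hA,
    lintegral_indicator (hA.inter measurableSet_Ioi)]

lemma frechetIntensity_Iic_zero : frechetIntensity (Set.Iic 0) = 0 := by
  rw [frechetIntensity_apply measurableSet_Iic]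
  simp [Set.Iic_inter_Ioi]

lemma ae_frechetIntensity_pos : ∀ᵐ u ∂frechetIntensity, 0 < u := by
  rw [ae_iff]
  simpa [Set.Iic] using frechetIntensity_Iic_zero

lemma frechetIntensity_Ioi {x : ℝ} (hx : 0 < x) :
    frechetIntensity (Set.Ioi x) = ENNReal.ofReal x⁻¹ := by
  have hsub : Set.Ioi x ∩ Set.Ioi 0 = Set.Ioi x := by
    rw [Set.Ioi_inter_Ioi]; simp [hx.le]
  have hcongr : ∀ u ∈ Set.Ioi x, u ^ (-2 : ℝ) = (u ^ 2)⁻¹ := fun u hu => by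
    rw [Real.rpow_neg (hx.trans hu).le]; norm_cast
  rw [frechetIntensity_apply measurableSet_Ioi, hsub, lintegral_indicator measurableSet_Ioi,
    ← ofReal_integral_eq_lintegral_ofReal]
  · rw [← setIntegral_congr_fun measurableSet_Ioi hcongr, integral_Ioi_rpow_of_lt (by norm_num) hx]
    congr 1
    rw [show (-2 : ℝ) + 1 = -1 by norm_num, Real.rpow_neg_one]
    ring
  · exact (integrableOn_Ioi_rpow_of_lt (a := -2) (by norm_num) hx).congr_fun hcongr measurableSet_Ioi
  · exact ae_of_all _ fun u => by positivity

/-- Dilating the Fréchet intensity by `a` multiplies it by `a`. -/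
lemma frechetIntensity_preimage_mul {a : ℝ} (ha : 0 < a) {A : Set ℝ} (hA : MeasurableSet A) :
    frechetIntensity ((fun u => a * u) ⁻¹' A) = ENNReal.ofReal a * frechetIntensity A := by
  have hm : Measurable fun u : ℝ => a * u := by fun_prop
  have hd : Measurable fun u : ℝ => ENNReal.ofReal ((u ^ 2)⁻¹) := by fun_prop
  have hg := hd.indicator (hA.inter (measurableSet_Ioi (a := (0 : ℝ))))
  have h1 : ∫⁻ u, (A ∩ Set.Ioi 0).indicator (fun u => ENNReal.ofReal ((u ^ 2)⁻¹)) (a * u) =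
      ENNReal.ofReal a⁻¹ * frechetIntensity A := by
    rw [← lintegral_map hg hm, Real.map_volume_mul_left ha.ne', lintegral_smul_measure,
      abs_of_pos (inv_pos.2 ha), frechetIntensity_apply hA, smul_eq_mul]
  have h2 : ∀ u, ((fun u => a * u) ⁻¹' A ∩ Set.Ioi 0).indicator
      (fun u => ENNReal.ofReal ((u ^ 2)⁻¹)) u = ENNReal.ofReal (a ^ 2) *
      (A ∩ Set.Ioi 0).indicator (fun u => ENNReal.ofReal ((u ^ 2)⁻¹)) (a * u) := by
    intro u
    by_cases hu : a * u ∈ A ∧ 0 < u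
    · have hu' : a * u ∈ A ∩ Set.Ioi 0 := ⟨hu.1, mul_pos ha hu.2⟩
      have hu'' : u ∈ (fun u => a * u) ⁻¹' A ∩ Set.Ioi 0 := hu
      rw [Set.indicator_of_mem hu', Set.indicator_of_mem hu'', ← ENNReal.ofReal_mul (by positivity)]
      congr 1
      have := hu.2.ne'
      field_simp
    · have hu' : a * u ∉ A ∩ Set.Ioi 0 := fun h => hu ⟨h.1, pos_of_mul_pos_right h.2 ha.le⟩
      have hu'' : u ∉ (fun u => a * u) ⁻¹' A ∩ Set.Ioi 0 := hu
      rw [Set.indicator_of_notMem hu', Set.indicator_of_notMem hu'', mul_zero]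
  rw [frechetIntensity_apply (hm hA)]
  simp_rw [h2]
  rw [lintegral_const_mul' _ _ ENNReal.ofReal_ne_top, h1, ← mul_assoc, ← ENNReal.ofReal_mul (by positivity)]
  congr 2
  field_simp

lemma frechetIntensity_exceed (a : ℝ≥0) {y : ℝ≥0} (hy : 0 < y) :
    frechetIntensity {u | y < u.toNNReal * a} = a / y := by
  rcases eq_or_ne a 0 with rfl | ha
  · simp
  · have ha' : (0 : ℝ) < a := by positivity
    have : {u : ℝ | y < u.toNNReal * a} = (fun u : ℝ => (a : ℝ) * u) ⁻¹' Set.Ioi (y : ℝ) := by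
      ext u
      simp only [Set.mem_preimage, Set.mem_Ioi, Set.mem_ofPred_eq]
      rcases le_or_gt u 0 with hu | hu
      · have h1 : (a : ℝ) * u ≤ y :=
          (mul_nonpos_of_nonneg_of_nonpos ha'.le hu).trans y.coe_nonneg
        simp [Real.toNNReal_of_nonpos hu, not_lt.2 h1]
      · rw [← NNReal.coe_lt_coe, NNReal.coe_mul, Real.coe_toNNReal _ hu.le, mul_comm]
    rw [this, frechetIntensity_preimage_mul ha' measurableSet_Ioi,
      frechetIntensity_Ioi (by exact_mod_cast hy), ENNReal.ofReal_inv_of_pos (by exact_mod_cast hy),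
      ENNReal.ofReal_coe_nnreal, ENNReal.ofReal_coe_nnreal, div_eq_mul_inv]

/-! ### The Borel sets of the path space -/

section

variable {d : ℕ}

/-- The boxes `{f | f (t j) ≤ x j for all j}` with positive bounds. -/
def pathBoxes (d : ℕ) : Set (Set (PathSpace d)) :=
  {B | ∃ (n : ℕ) (t : Fin n → EuclideanSpace ℝ (Fin d)) (x : Fin n → ℝ≥0),
    (∀ j, 0 < x j) ∧ B = {f | ∀ j, f (t j) ≤ x j}}

lemma isPiSystem_pathBoxes : IsPiSystem (pathBoxes d) := by
  rintro _ ⟨n, t, x, hx, rfl⟩ _ ⟨m, s, y, hy, rfl⟩ -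
  refine ⟨n + m, Fin.append t s, Fin.append x y, fun j => ?_, ?_⟩
  · refine Fin.addCases (fun j => ?_) (fun j => ?_) j <;> simp [hx, hy]
  · ext f
    constructor
    · rintro ⟨h1, h2⟩ j
      refine Fin.addCases (fun j => ?_) (fun j => ?_) j
      · simpa using h1 j
      · simpa using h2 j
    · intro h
      exact ⟨fun j => by simpa using h (Fin.castAdd m j), fun j => by simpa using h (Fin.natAdd n j)⟩

/-- The σ-algebra is arbitrary, so the lemma can be used for the one generated by boxes. A compact
image inside `U` keeps a positive distance from the complement of `U`, and by continuity this can be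
tested on a countable dense subset of `K`. -/
lemma measurableSet_mapsTo_of_measurable_eval {m : MeasurableSpace (PathSpace d)}
    (hm : ∀ t, Measurable[m] fun f : PathSpace d => f t)
    {K : Set (EuclideanSpace ℝ (Fin d))} (hK : IsCompact K) {U : Set ℝ≥0} (hU : IsOpen U) :
    MeasurableSet[m] {f : PathSpace d | Set.MapsTo f K U} := by
  obtain ⟨D, hDK, hDc, hD⟩ :=
    (TopologicalSpace.IsSeparable.of_separableSpace K).exists_countable_dense_subset
  let F : ℕ → Set ℝ≥0 := fun n => {y | ∀ z ∈ Uᶜ, ((n : ℝ) + 1)⁻¹ ≤ dist y z}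
  have hF : ∀ n, IsClosed (F n) := fun n => by
    simp only [F, Set.ofPred_forall]
    exact isClosed_iInter fun z => isClosed_iInter fun _ =>
      isClosed_le continuous_const (by fun_prop)
  have key : {f : PathSpace d | Set.MapsTo f K U} = ⋃ n, ⋂ t ∈ D, {f | f t ∈ F n} := by
    ext f
    simp only [Set.mem_iUnion, Set.mem_iInter]
    constructor
    · intro hf
      obtain ⟨δ, hδ, hsub⟩ := (hK.image f.continuous).exists_thickening_subset_open hU
        (Set.mapsTo_iff_image_subset.1 hf)
      obtain ⟨n, hn⟩ := exists_nat_one_div_lt hδ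
      refine ⟨n, fun t ht z hz => ?_⟩
      by_contra! hlt
      refine hz (hsub (Metric.mem_thickening_iff.2 ⟨f t, ⟨t, hDK ht, rfl⟩, ?_⟩))
      rw [dist_comm]
      rw [one_div] at hn
      exact hlt.trans hn
    · rintro ⟨n, hn⟩ t ht
      have hcl : IsClosed {t | f t ∈ F n} := (hF n).preimage f.continuous
      have htF : f t ∈ F n := hcl.closure_subset_iff.2 (fun s hs => hn s hs) (hD ht)
      by_contra hU'
      have h0 := htF (f t) hU'
      rw [dist_self] at h0
      have : (0 : ℝ) < ((n : ℝ) + 1)⁻¹ := by positivity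
      linarith
  rw [key]
  exact MeasurableSet.iUnion fun n => MeasurableSet.biInter hDc fun t _ =>
    hm t (hF n).measurableSet

/-- Boxes only have positive bounds, since exceedances of level zero may have infinite mass; level
zero is recovered as a countable intersection. -/
lemma measurable_of_forall_pos_le {β : Type*} [MeasurableSpace β] {g : β → ℝ≥0}
    (hg : ∀ x : ℝ≥0, 0 < x → MeasurableSet {b | g b ≤ x}) : Measurable g := by
  refine measurable_of_Iic fun x => ?_
  have : g ⁻¹' Set.Iic x = ⋂ n : ℕ, {b | g b ≤ x + ((n : ℝ≥0) + 1)⁻¹} := by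
    ext b
    simp only [Set.mem_preimage, Set.mem_Iic, Set.mem_iInter, Set.mem_ofPred_eq]
    refine ⟨fun h n => h.trans le_self_add, fun h => le_of_forall_pos_le_add fun ε hε => ?_⟩
    obtain ⟨n, hn⟩ := exists_nat_one_div_lt hε
    rw [one_div] at hn
    exact (h n).trans (by gcongr)
  rw [this]
  exact MeasurableSet.iInter fun n => hg _ (by positivity)

lemma pathSpace_measurableSpace_eq :
    PathSpace.measurableSpace d = MeasurableSpace.generateFrom (pathBoxes d) := by
  refine le_antisymm ?_ ?_
  · have h := borel_eq_generateFrom_of_subbasis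
      (ContinuousMap.compactOpen_eq (X := EuclideanSpace ℝ (Fin d)) (Y := ℝ≥0))
    change borel (PathSpace d) ≤ _
    rw [h]
    refine MeasurableSpace.generateFrom_le ?_
    rintro _ ⟨K, hK, U, hU, rfl⟩
    refine measurableSet_mapsTo_of_measurable_eval (fun t => ?_) hK hU
    have hpos : ∀ x : ℝ≥0, 0 < x →
        MeasurableSet[MeasurableSpace.generateFrom (pathBoxes d)] {f : PathSpace d | f t ≤ x} :=
      fun x hx => MeasurableSpace.measurableSet_generateFrom
        ⟨1, fun _ => t, fun _ => x, fun _ => hx, by simp⟩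
    exact @measurable_of_forall_pos_le _ (_) _ hpos
  · refine MeasurableSpace.generateFrom_le ?_
    rintro _ ⟨n, t, x, -, rfl⟩
    simp only [Set.ofPred_forall]
    exact MeasurableSet.iInter fun j => measurableSet_le (measurable_pathEval _) measurable_const

/-- Measures on the path space which charge exceedance sets equally, and finitely for one-point
exceedances, agree off the zero path. -/
lemma restrict_eq_of_exceedance {η η' : Measure (PathSpace d)}
    (hfin : ∀ (t : EuclideanSpace ℝ (Fin d)) (x : ℝ≥0), 0 < x → η {f | x < f t} ≠ ∞)
    (h : ∀ (n : ℕ) (t : Fin n → EuclideanSpace ℝ (Fin d)) (x : Fin n → ℝ≥0), (∀ j, 0 < x j) →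
      η {f | ∃ j, x j < f (t j)} = η' {f | ∃ j, x j < f (t j)}) :
    η.restrict {f | f ≠ 0} = η'.restrict {f | f ≠ 0} := by
  have hm : ∀ t x, MeasurableSet {f : PathSpace d | x < f t} := fun t x =>
    measurableSet_lt measurable_const (measurable_pathEval t)
  have hmE : ∀ (n : ℕ) (t : Fin n → EuclideanSpace ℝ (Fin d)) (x : Fin n → ℝ≥0),
      MeasurableSet {f : PathSpace d | ∃ j, x j < f (t j)} := fun n t x => by
    simp only [Set.ofPred_exists]
    exact MeasurableSet.iUnion fun j => hm _ _
  have hfinE : ∀ (n : ℕ) (t : Fin n → EuclideanSpace ℝ (Fin d)) (x : Fin n → ℝ≥0),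
      (∀ j, 0 < x j) → η {f | ∃ j, x j < f (t j)} ≠ ∞ := fun n t x hx => by
    simp only [Set.ofPred_exists]
    refine ((measure_iUnion_le _).trans_lt ?_).ne
    rw [tsum_fintype]
    exact ENNReal.sum_lt_top.2 fun j _ => (hfin _ _ (hx j)).lt_top
  have hone : ∀ t x, 0 < x → η {f : PathSpace d | x < f t} = η' {f | x < f t} := fun t x hx => by
    simpa using h 1 (fun _ => t) (fun _ => x) fun _ => hx
  have hcover : {f : PathSpace d | f ≠ 0} = ⋃ q : ℕ × ℕ,
      {f | ((q.2 : ℝ≥0) + 1)⁻¹ < f (TopologicalSpace.denseSeq _ q.1)} := by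
    ext f
    simp only [Set.mem_iUnion, Set.mem_ofPred_eq, Prod.exists]
    constructor
    · intro hf
      have : ∃ t, 0 < f t := by
        by_contra! hcon
        exact hf (ContinuousMap.ext fun t => le_antisymm (hcon t) zero_le)
      obtain ⟨s, hs⟩ := this
      obtain ⟨t, ht, k, rfl⟩ := (TopologicalSpace.denseRange_denseSeq _).inter_open_nonempty _
        (isOpen_lt continuous_const f.continuous : IsOpen {t | 0 < f t}) ⟨s, hs⟩
      obtain ⟨n, hn⟩ := exists_nat_one_div_lt (K := ℝ≥0) ht
      exact ⟨k, n, by rwa [one_div] at hn⟩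
    · rintro ⟨k, n, h⟩ rfl
      simp at h
  -- The non-zero paths are a countable union of one-point exceedance sets of finite mass, so it
  -- suffices to compare the measures on each of these by a π-system argument.
  rw [hcover, Measure.restrict_iUnion_congr]
  rintro ⟨k, n⟩
  set t₀ := TopologicalSpace.denseSeq (EuclideanSpace ℝ (Fin d)) k
  set ε : ℝ≥0 := ((n : ℝ≥0) + 1)⁻¹
  have hε : 0 < ε := by positivity
  have hD := hm t₀ ε
  have : IsFiniteMeasure (η.restrict {f | ε < f t₀}) :=
    ⟨by rw [Measure.restrict_apply_univ]; exact (hfin t₀ ε hε).lt_top⟩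
  refine ext_of_generate_finite (pathBoxes d) pathSpace_measurableSpace_eq isPiSystem_pathBoxes
    ?_ ?_
  · rintro _ ⟨m, t, x, hx, rfl⟩
    have hx' : ∀ j : Fin (m + 1), 0 < (Fin.cons ε x : Fin (m + 1) → ℝ≥0) j := by
      intro j
      refine Fin.cases ?_ (fun j => ?_) j <;> simp [hε, hx]
    have hbox : MeasurableSet {f : PathSpace d | ∀ j, f (t j) ≤ x j} := by
      simp only [Set.ofPred_forall]
      exact MeasurableSet.iInter fun j => measurableSet_le (measurable_pathEval _) measurable_const
    -- Adjoining `(t₀, ε)` to the list writes the trace of a box as a difference of two nested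
    -- exceedance sets, whose masses are known.
    have hset : {f : PathSpace d | ∀ j, f (t j) ≤ x j} ∩ {f | ε < f t₀} =
        {f | ∃ j, (Fin.cons ε x : Fin (m + 1) → ℝ≥0) j <
          f ((Fin.cons t₀ t : Fin (m + 1) → EuclideanSpace ℝ (Fin d)) j)} \
          {f | ∃ j, x j < f (t j)} := by
      ext f
      simp only [Set.mem_inter_iff, Set.mem_ofPred_eq, Set.mem_sdiff, Fin.exists_fin_succ,
        Fin.cons_zero, Fin.cons_succ, not_exists, not_lt]
      constructor
      · rintro ⟨h1, h2⟩
        exact ⟨Or.inl h2, h1⟩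
      · rintro ⟨h1 | ⟨j, hj⟩, h2⟩
        · exact ⟨h2, h1⟩
        · exact absurd hj (not_lt.2 (h2 j))
    have hsub : {f : PathSpace d | ∃ j, x j < f (t j)} ⊆
        {f | ∃ j, (Fin.cons ε x : Fin (m + 1) → ℝ≥0) j <
          f ((Fin.cons t₀ t : Fin (m + 1) → EuclideanSpace ℝ (Fin d)) j)} := by
      rintro f ⟨j, hj⟩
      exact ⟨j.succ, by simpa using hj⟩
    rw [Measure.restrict_apply hbox, Measure.restrict_apply hbox, hset,
      measure_sdiff hsub (hmE _ _ _).nullMeasurableSet (hfinE _ _ _ hx),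
      measure_sdiff hsub (hmE _ _ _).nullMeasurableSet (by rw [← h _ _ _ hx]; exact hfinE _ _ _ hx),
      h _ _ _ hx, h _ _ _ hx']
  · simp only [Measure.restrict_apply_univ]
    exact hone _ _ hε

end

/-! ### The exponent measure and the profile measure -/

section

variable {d : ℕ}

/-- The exponent measure: the image of `u⁻² du × p` under `(u, f) ↦ u f`. -/
noncomputable def exponentMeasure (p : Measure (PathSpace d)) : Measure (PathSpace d) :=
  (frechetIntensity.prod p).map fun q => q.1.toNNReal • q.2

/-- The measure `B ↦ ∫ γ(f) 1{(τ(f), f(· + τ(f)) / γ(f)) ∈ B} p(df)`. -/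
noncomputable def profileMeasure (p : Measure (PathSpace d)) :
    Measure (EuclideanSpace ℝ (Fin d) × PathSpace d) :=
  (p.withDensity fun f => (pathSup f : ℝ≥0∞)).map
    fun f => (firstArgmax f, centredPath (pathSup f) f)

/-- The map `(u, f) ↦ (u γ(f), τ(f), f(· + τ(f)) / γ(f))`. -/
noncomputable def centredMap (q : ℝ × PathSpace d) :
    ℝ × EuclideanSpace ℝ (Fin d) × PathSpace d :=
  (q.1 * pathSup q.2, firstArgmax q.2, centredPath (pathSup q.2) q.2)

@[fun_prop] lemma measurable_smulPath :
    Measurable fun q : ℝ × PathSpace d => q.1.toNNReal • q.2 :=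
  continuous_smulPath.measurable.comp (measurable_fst.real_toNNReal.prodMk measurable_snd)

@[fun_prop] lemma measurable_profile :
    Measurable fun f : PathSpace d => (firstArgmax f, centredPath (pathSup f) f) :=
  measurable_firstArgmax.prodMk
    (measurable_centredPath.comp (measurable_pathSup.prodMk measurable_id))

@[fun_prop] lemma measurable_centredMap : Measurable (centredMap (d := d)) :=
  (measurable_fst.mul (measurable_pathSup.comp measurable_snd).coe_nnreal_real).prodMk
    (measurable_profile.comp measurable_snd)

lemma measurable_coe_pathSup : Measurable fun f : PathSpace d => (pathSup f : ℝ≥0∞) :=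
  measurable_pathSup.coe_nnreal_ennreal

instance (p : Measure (PathSpace d)) [SFinite p] : SFinite (profileMeasure p) := by
  unfold profileMeasure; infer_instance

lemma lintegral_profileMeasure (p : Measure (PathSpace d))
    {φ : EuclideanSpace ℝ (Fin d) × PathSpace d → ℝ≥0∞} (hφ : Measurable φ) :
    ∫⁻ y, φ y ∂(profileMeasure p) =
      ∫⁻ f, pathSup f * φ (firstArgmax f, centredPath (pathSup f) f) ∂p := by
  rw [profileMeasure, lintegral_map hφ measurable_profile,
    lintegral_withDensity_eq_lintegral_mul _ measurable_coe_pathSup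
      (g := fun f => φ (firstArgmax f, centredPath (pathSup f) f)) (hφ.comp measurable_profile)]
  rfl

lemma profileMeasure_apply (p : Measure (PathSpace d))
    {B : Set (EuclideanSpace ℝ (Fin d) × PathSpace d)} (hB : MeasurableSet B) :
    profileMeasure p B = ∫⁻ f, pathSup f *
      B.indicator 1 (firstArgmax f, centredPath (pathSup f) f) ∂p := by
  rw [← lintegral_profileMeasure p (measurable_one.indicator hB), lintegral_indicator_one hB]

/-- The intensity of the centred process factorises. -/
lemma map_centredMap_restrict (p : Measure (PathSpace d)) [SFinite p] :
    ((frechetIntensity.prod p).map centredMap).restrict {q | 0 < q.1} =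
      frechetIntensity.prod (profileMeasure p) := by
  have hpos : MeasurableSet {q : ℝ × EuclideanSpace ℝ (Fin d) × PathSpace d | 0 < q.1} :=
    measurableSet_lt measurable_const measurable_fst
  ext B hB
  have hsec : Measurable fun y => frechetIntensity ((fun v => (v, y)) ⁻¹' B) :=
    measurable_measure_prodMk_right hB
  rw [Measure.restrict_apply hB, Measure.map_apply measurable_centredMap (hB.inter hpos),
    Measure.prod_apply_symm (measurable_centredMap (hB.inter hpos)), Measure.prod_apply_symm hB,
    lintegral_profileMeasure p hsec]
  refine lintegral_congr fun f => ?_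
  set y := (firstArgmax f, centredPath (pathSup f) f) with hy
  rcases eq_or_ne (pathSup f) 0 with h0 | h0
  · have : (fun u => (u, f)) ⁻¹' (centredMap ⁻¹' (B ∩ {q | 0 < q.1})) = ∅ := by
      ext u; simp [centredMap, h0]
    rw [this, measure_empty, h0, ENNReal.coe_zero, zero_mul]
  · have h0' : (0 : ℝ) < pathSup f := by positivity
    have hA : MeasurableSet ((fun v => (v, y)) ⁻¹' B) := measurable_prodMk_right hB
    -- For fixed `f` the centring acts on `u` as dilation by `γ`; this produces the weight `γ` in
    -- the profile measure.
    have h1 : (fun u => (u, f)) ⁻¹' (centredMap ⁻¹' (B ∩ {q | 0 < q.1})) =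
        (fun u => (pathSup f : ℝ) * u) ⁻¹' ((fun v => (v, y)) ⁻¹' B ∩ Set.Ioi 0) := by
      ext u
      simp [centredMap, hy, mul_comm (pathSup f : ℝ)]
    rw [h1, frechetIntensity_preimage_mul h0' (hA.inter measurableSet_Ioi),
      ENNReal.ofReal_coe_nnreal]
    congr 1
    exact measure_inter_conull (by rw [Set.compl_Ioi]; exact frechetIntensity_Iic_zero)

lemma exponentMeasure_exceed (p : Measure (PathSpace d)) [SFinite p] (t : EuclideanSpace ℝ (Fin d))
    {x : ℝ≥0} (hx : 0 < x) : exponentMeasure p {f | x < f t} = (∫⁻ f, f t ∂p) / x := by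
  have hm : MeasurableSet {f : PathSpace d | x < f t} :=
    measurableSet_lt measurable_const (measurable_pathEval t)
  rw [exponentMeasure, Measure.map_apply measurable_smulPath hm,
    Measure.prod_apply_symm (measurable_smulPath hm)]
  simp_rw [div_eq_mul_inv]
  rw [← lintegral_mul_const _ (measurable_pathEval t).coe_nnreal_ennreal]
  refine lintegral_congr fun f => ?_
  rw [← div_eq_mul_inv, ← frechetIntensity_exceed (f t) hx]
  rfl

/-- The paths with supremum above `1` and normalised profile in `B`. -/
def profileEvent (B : Set (EuclideanSpace ℝ (Fin d) × PathSpace d)) : Set (PathSpace d) :=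
  {g | 1 < pathSup g ∧ (firstArgmax g, centredPath (pathSup g) g) ∈ B}

lemma measurableSet_profileEvent {B : Set (EuclideanSpace ℝ (Fin d) × PathSpace d)}
    (hB : MeasurableSet B) : MeasurableSet (profileEvent B) :=
  (measurableSet_lt measurable_const measurable_pathSup).inter (measurable_profile hB)

/-- Multiplying a path by `u > 0` changes its supremum but neither its first maximiser nor its
normalised profile. The threshold `1` is chosen because `u⁻² du` gives `(1, ∞)` mass one. -/
lemma exponentMeasure_profileEvent (p : Measure (PathSpace d)) [SFinite p]
    {B : Set (EuclideanSpace ℝ (Fin d) × PathSpace d)} (hB : MeasurableSet B) :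
    exponentMeasure p (profileEvent B) = profileMeasure p B := by
  have hpos : MeasurableSet {q : ℝ × EuclideanSpace ℝ (Fin d) × PathSpace d | 0 < q.1} :=
    measurableSet_lt measurable_const measurable_fst
  have hB' : MeasurableSet (Set.Ioi (1 : ℝ) ×ˢ B) := measurableSet_Ioi.prod hB
  have h1 : frechetIntensity.prod (profileMeasure p) (Set.Ioi (1 : ℝ) ×ˢ B) =
      profileMeasure p B := by
    rw [Measure.prod_prod, frechetIntensity_Ioi one_pos]; simp
  have h2 : Set.Ioi (1 : ℝ) ×ˢ B ∩ {q | 0 < q.1} = Set.Ioi (1 : ℝ) ×ˢ B :=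
    Set.inter_eq_left.2 fun q hq => (zero_lt_one.trans hq.1 : (0 : ℝ) < q.1)
  rw [← h1, ← map_centredMap_restrict, Measure.restrict_apply hB', h2,
    Measure.map_apply measurable_centredMap hB', exponentMeasure,
    Measure.map_apply measurable_smulPath (measurableSet_profileEvent hB)]
  refine measure_congr ?_
  have hae : ∀ᵐ q ∂(frechetIntensity.prod p), 0 < q.1 :=
    Measure.quasiMeasurePreserving_fst.ae ae_frechetIntensity_pos
  filter_upwards [hae] with q hq
  have ha : 0 < q.1.toNNReal := Real.toNNReal_pos.2 hq
  refine propext ?_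
  change (1 < pathSup (q.1.toNNReal • q.2) ∧ (firstArgmax (q.1.toNNReal • q.2),
    centredPath (pathSup (q.1.toNNReal • q.2)) (q.1.toNNReal • q.2)) ∈ B) ↔
    (1 < q.1 * (pathSup q.2 : ℝ) ∧ (firstArgmax q.2, centredPath (pathSup q.2) q.2) ∈ B)
  rw [pathSup_smul, firstArgmax_smul ha, centredPath_smul ha, ← NNReal.coe_lt_coe,
    NNReal.coe_mul, Real.coe_toNNReal _ hq.le, NNReal.coe_one]

lemma ae_exponentMeasure_vanishing {p : Measure (PathSpace d)} [SFinite p]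
    (hV : ∀ᵐ f ∂p, f ∈ vanishingPaths d) : ∀ᵐ f ∂(exponentMeasure p), f ∈ vanishingPaths d := by
  rw [exponentMeasure, ae_map_iff (p := fun f => f ∈ vanishingPaths d)
    measurable_smulPath.aemeasurable measurableSet_vanishingPaths]
  have hae : ∀ᵐ q ∂(frechetIntensity.prod p), q.2 ∈ vanishingPaths d :=
    Measure.quasiMeasurePreserving_snd.ae hV
  filter_upwards [hae] with q hq
  have : Filter.Tendsto (fun t => q.1.toNNReal * q.2 t) (Bornology.cobounded _)
      (𝓝 (q.1.toNNReal * 0)) := Filter.Tendsto.const_mul _ hq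
  rwa [mul_zero] at this

lemma measurable_shiftPath (h : EuclideanSpace ℝ (Fin d)) :
    Measurable (shiftPath h : PathSpace d → PathSpace d) :=
  (continuous_shiftPath.comp (continuous_const.prodMk continuous_id)).measurable

/-- Shift invariance of the exponent measure makes the profile measure translation invariant. -/
lemma profileMeasure_translate {p : Measure (PathSpace d)} [SFinite p]
    (hV : ∀ᵐ f ∂p, f ∈ vanishingPaths d) {h : EuclideanSpace ℝ (Fin d)}
    (hinv : (exponentMeasure p).restrict {f | f ≠ 0} =
      ((exponentMeasure p).map (shiftPath h)).restrict {f | f ≠ 0})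
    {B : Set (EuclideanSpace ℝ (Fin d) × PathSpace d)} (hB : MeasurableSet B) :
    profileMeasure p ((fun y => (y.1 - h, y.2)) ⁻¹' B) = profileMeasure p B := by
  have hT : Measurable fun y : EuclideanSpace ℝ (Fin d) × PathSpace d => (y.1 - h, y.2) := by
    fun_prop
  have hE := measurableSet_profileEvent hB
  -- Shift invariance is available only off the zero path, which the requirement of a supremum above
  -- `1` excludes.
  have hne : profileEvent B ∩ {f | f ≠ 0} = profileEvent B := by
    refine Set.inter_eq_left.2 ?_
    rintro f hf rfl
    have h0 : pathSup (0 : PathSpace d) = 0 := by simp [pathSup]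
    have := hf.1
    rw [h0] at this
    exact not_lt.2 zero_le_one this
  rw [← exponentMeasure_profileEvent p hB, ← exponentMeasure_profileEvent p (hT hB), ← hne,
    ← Measure.restrict_apply hE, hinv, Measure.restrict_apply hE, hne,
    Measure.map_apply (measurable_shiftPath h) hE]
  refine measure_congr ?_
  filter_upwards [ae_exponentMeasure_vanishing hV] with g hg
  refine propext ?_
  change (1 < pathSup g ∧ (firstArgmax g - h, centredPath (pathSup g) g) ∈ B) ↔
    (1 < pathSup (shiftPath h g) ∧ (firstArgmax (shiftPath h g),
      centredPath (pathSup (shiftPath h g)) (shiftPath h g)) ∈ B)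
  rw [pathSup_shiftPath]
  refine and_congr_right fun h1 => ?_
  have hex := exists_isFirstArgmax hg (zero_lt_one.trans h1)
  rw [centredPath_shiftPath hex]
  obtain ⟨t, ht⟩ := hex
  rw [(ht.shiftPath h).firstArgmax_eq, ht.firstArgmax_eq]

/-- Factorisation of a measure on `E × F` which is invariant under translations of `E`. -/
lemma exists_eq_prod_of_translate {E F : Type*} [NormedAddCommGroup E] [NormedSpace ℝ E]
    [FiniteDimensional ℝ E] [MeasurableSpace E] [BorelSpace E] [MeasurableSpace F]
    (μ : Measure E) [μ.IsAddHaarMeasure] (ν : Measure (E × F))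
    (hfin : ∀ K : Set E, IsCompact K → ν (K ×ˢ Set.univ) < ∞)
    (hinv : ∀ (h : E) (B : Set (E × F)), MeasurableSet B →
      ν ((fun y => (y.1 - h, y.2)) ⁻¹' B) = ν B) :
    ∃ ρ : Measure F, IsFiniteMeasure ρ ∧ ν = μ.prod ρ := by
  have : ProperSpace E := FiniteDimensional.proper ℝ E
  have : SecondCountableTopology E := secondCountable_of_proper
  -- For fixed `A`, the map `K ↦ ν(K × A)` is locally finite and translation invariant, hence a
  -- multiple of `μ`, with a constant depending on `A`.
  have hA : ∀ A : Set F, MeasurableSet A → ∃ c : ℝ≥0∞, ∀ K : Set E, MeasurableSet K →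
      ν (K ×ˢ A) = c * μ K := by
    intro A hA
    let νA := (ν.restrict (Set.univ ×ˢ A)).map Prod.fst
    have happ : ∀ K : Set E, MeasurableSet K → νA K = ν (K ×ˢ A) := by
      intro K hK
      rw [Measure.map_apply measurable_fst hK, Measure.restrict_apply (measurable_fst hK)]
      congr 1
      ext y; simp
    have h1 : IsFiniteMeasureOnCompacts νA := ⟨fun K hK => by
      rw [happ K hK.measurableSet]
      exact (measure_mono (Set.prod_mono le_rfl (Set.subset_univ A))).trans_lt (hfin K hK)⟩
    have h2 : νA.IsAddLeftInvariant := ⟨fun h => by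
      ext K hK
      have hm : Measurable fun x : E => h + x := by fun_prop
      rw [Measure.map_apply hm hK, happ _ (hm hK), happ _ hK, ← hinv (-h) _ (hK.prod hA)]
      congr 1
      ext y; simp [add_comm]⟩
    refine ⟨(νA.addHaarScalarFactor μ : ℝ≥0), fun K hK => ?_⟩
    rw [← happ K hK]
    conv_lhs => rw [Measure.isAddLeftInvariant_eq_smul νA μ]
    rfl
  -- Evaluating at one set of positive finite mass shows that the constant is a measure in `A`.
  let K₀ : Set E := Metric.closedBall 0 1
  have hK₀ : MeasurableSet K₀ := Metric.isClosed_closedBall.measurableSet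
  have hpos : μ K₀ ≠ 0 := (Metric.measure_closedBall_pos μ _ one_pos).ne'
  have htop : μ K₀ ≠ ∞ := (isCompact_closedBall (0 : E) 1).measure_lt_top.ne
  let ρ : Measure F := (μ K₀)⁻¹ • (ν.restrict (K₀ ×ˢ Set.univ)).map Prod.snd
  have hρ : ∀ A, MeasurableSet A → ρ A = (μ K₀)⁻¹ * ν (K₀ ×ˢ A) := by
    intro A hA
    rw [Measure.smul_apply, Measure.map_apply measurable_snd hA,
      Measure.restrict_apply (measurable_snd hA), smul_eq_mul]
    congr 2
    ext y; simp [and_comm]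
  have hρfin : IsFiniteMeasure ρ := ⟨by
    rw [hρ _ MeasurableSet.univ]
    exact ENNReal.mul_lt_top (ENNReal.inv_lt_top.2 (pos_iff_ne_zero.2 hpos))
      (hfin K₀ (isCompact_closedBall 0 1))⟩
  refine ⟨ρ, hρfin, (Measure.prod_eq fun K A hK hAm => ?_).symm⟩
  obtain ⟨c, hc⟩ := hA A hAm
  rw [hρ A hAm, hc K hK, hc K₀ hK₀, mul_comm c (μ K₀), ← mul_assoc _ (μ K₀), ENNReal.inv_mul_cancel hpos htop,
    one_mul, mul_comm]

end

/-! ### The law of the normalised shape function -/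

section

variable {d : ℕ}

lemma measurable_uncurry_path :
    Measurable fun q : PathSpace d × EuclideanSpace ℝ (Fin d) => (q.1 q.2 : ℝ≥0∞) := by
  have : Continuous fun q : PathSpace d × EuclideanSpace ℝ (Fin d) => q.1 q.2 := by fun_prop
  exact this.measurable.coe_nnreal_ennreal

/-- When `τ` lies in `K`, the supremum is attained in `K`, so the weight `γ` is at most the maximum
over `K`. -/
lemma profileMeasure_compact_lt_top {p : Measure (PathSpace d)}
    (hV : ∀ᵐ f ∂p, f ∈ vanishingPaths d)
    (hmax : ∀ K : Set (EuclideanSpace ℝ (Fin d)), IsCompact K →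
      ∫⁻ f, ⨆ t ∈ K, (f t : ℝ≥0∞) ∂p < ∞)
    {K : Set (EuclideanSpace ℝ (Fin d))} (hK : IsCompact K) :
    profileMeasure p (K ×ˢ Set.univ) < ∞ := by
  rw [profileMeasure_apply p (hK.measurableSet.prod MeasurableSet.univ)]
  refine (lintegral_mono_ae ?_).trans_lt (hmax K hK)
  filter_upwards [hV] with f hf
  by_cases hmem : firstArgmax f ∈ K
  · rw [Set.indicator_of_mem (Set.mk_mem_prod hmem (Set.mem_univ _)), Pi.one_apply, mul_one]
    rcases eq_or_ne (pathSup f) 0 with h0 | h0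
    · simp [h0]
    · obtain ⟨t, ht⟩ := exists_isFirstArgmax hf (pos_iff_ne_zero.2 h0)
      rw [ht.firstArgmax_eq] at hmem
      rw [ht.pathSup_eq]
      exact le_iSup₂ (f := fun t (_ : t ∈ K) => (f t : ℝ≥0∞)) t hmem
  · rw [Set.indicator_of_notMem fun h => hmem h.1, mul_zero]
    exact zero_le

/-- The value of a path at a point is recovered from its normalised profile. -/
lemma pathSup_mul_centredPath {f : PathSpace d} (hf : f ∈ vanishingPaths d)
    (t : EuclideanSpace ℝ (Fin d)) :
    pathSup f * centredPath (pathSup f) f (t - firstArgmax f) = f t := by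
  have hle : f t ≤ pathSup f := le_ciSup (bddAbove_of_mem_vanishingPaths hf) t
  rcases eq_or_ne (pathSup f) 0 with h0 | h0
  · rw [h0, zero_mul]
    rw [h0] at hle
    exact (le_antisymm hle zero_le).symm
  · rw [centredPath, ContinuousMap.smul_apply, shiftPath_apply, sub_add_cancel, smul_eq_mul,
      mul_inv_cancel_left₀ h0]

/-- Spectral decomposition: the profile measure of a Brown–Resnick stationary law of vanishing paths
is the product of a multiple of Lebesgue measure and a probability measure. -/
lemma exists_shape_law {p : Measure (PathSpace d)} [IsProbabilityMeasure p]
    (hV : ∀ᵐ f ∂p, f ∈ vanishingPaths d) (hmean : ∀ t, ∫⁻ f, (f t : ℝ≥0∞) ∂p = 1)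
    (hmax : ∀ K : Set (EuclideanSpace ℝ (Fin d)), IsCompact K →
      ∫⁻ f, ⨆ t ∈ K, (f t : ℝ≥0∞) ∂p < ∞)
    (hinv : ∀ h, (exponentMeasure p).restrict {f | f ≠ 0} =
      ((exponentMeasure p).map (shiftPath h)).restrict {f | f ≠ 0}) :
    ∃ (c : ℝ≥0) (Q : Measure (PathSpace d)), 0 < c ∧ IsProbabilityMeasure Q ∧
      profileMeasure p = (c : ℝ≥0∞) • (volume : Measure (EuclideanSpace ℝ (Fin d))).prod Q ∧
      c * ∫⁻ f, ∫⁻ t, (f t : ℝ≥0∞) ∂(volume : Measure (EuclideanSpace ℝ (Fin d))) ∂Q = 1 := by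
  obtain ⟨ρ, hρfin, hρ⟩ := exists_eq_prod_of_translate
    (volume : Measure (EuclideanSpace ℝ (Fin d))) (profileMeasure p)
    (fun K hK => profileMeasure_compact_lt_top hV hmax hK)
    (fun h B hB => profileMeasure_translate hV (hinv h) hB)
  -- Integrate the profile value at `0 - τ`: weighted by `γ` it is `W(0)`, of mean `1`, while the
  -- product form gives the integral of the shape after the substitution `s ↦ 0 - s`.
  have hmass : ∫⁻ f, ∫⁻ t, (f t : ℝ≥0∞) ∂(volume : Measure (EuclideanSpace ℝ (Fin d))) ∂ρ = 1 := by
    have hφ : Measurable fun y : EuclideanSpace ℝ (Fin d) × PathSpace d =>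
        (y.2 (0 - y.1) : ℝ≥0∞) :=
      measurable_uncurry_path.comp (measurable_snd.prodMk (measurable_const.sub measurable_fst))
    have h1 := lintegral_profileMeasure p hφ
    have h2 : ∫⁻ f, pathSup f * (centredPath (pathSup f) f (0 - firstArgmax f) : ℝ≥0∞) ∂p = 1 := by
      rw [← hmean 0]
      refine lintegral_congr_ae ?_
      filter_upwards [hV] with f hf
      rw [← ENNReal.coe_mul, pathSup_mul_centredPath hf]
    rw [h2, hρ, lintegral_prod_symm _ hφ.aemeasurable] at h1
    rw [← h1]
    refine lintegral_congr fun f => ?_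
    exact (lintegral_sub_left_eq_self (fun t => (f t : ℝ≥0∞)) 0).symm
  have hne : ρ Set.univ ≠ 0 := by
    intro h0
    rw [Measure.measure_univ_eq_zero] at h0
    simp [h0] at hmass
  have htop : ρ Set.univ ≠ ∞ := measure_ne_top _ _
  have hc : ((ρ Set.univ).toNNReal : ℝ≥0∞) = ρ Set.univ := ENNReal.coe_toNNReal htop
  have hρQ : ρ = ρ Set.univ • ((ρ Set.univ)⁻¹ • ρ) := by
    rw [smul_smul, ENNReal.mul_inv_cancel hne htop, one_smul]
  refine ⟨(ρ Set.univ).toNNReal, (ρ Set.univ)⁻¹ • ρ, ENNReal.toNNReal_pos hne htop, ⟨?_⟩, ?_, ?_⟩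
  · rw [Measure.smul_apply, smul_eq_mul, ENNReal.inv_mul_cancel hne htop]
  · rw [hc, ← Measure.prod_smul_right, ← hρQ, hρ]
  · rw [hc, ← hmass, lintegral_smul_measure, smul_eq_mul, ← mul_assoc,
      ENNReal.mul_inv_cancel hne htop, one_mul]

/-- The conditional law disintegrates the joint law of `(γ, W)`, under which `y` equals `γ(W)`; the
tilted integral is thus the expectation of `γ` over the event on `(τ, W(· + τ)/γ)`. -/
lemma tiltedProb_eq_profileMeasure {Ω : Type*} [MeasurableSpace Ω] (P : Measure Ω)
    [IsProbabilityMeasure P] {W : Ω → PathSpace d} (hW : Measurable W) {A : Set (PathSpace d)}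
    (hA : MeasurableSet A) {K : Set (EuclideanSpace ℝ (Fin d))} (hK : MeasurableSet K) :
    tiltedProb P W A K = profileMeasure (P.map W) (K ×ˢ A) := by
  have hγ : Measurable fun ω => pathSup (W ω) := measurable_pathSup.comp hW
  let D : Set (ℝ≥0 × PathSpace d) := {q | centredPath q.1 q.2 ∈ A ∧ firstArgmax q.2 ∈ K}
  have hD : MeasurableSet D :=
    (measurable_centredPath hA).inter ((measurable_firstArgmax.comp measurable_snd) hK)
  let φ : ℝ≥0 × PathSpace d → ℝ≥0∞ := fun q => q.1 * D.indicator 1 q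
  have hφ : Measurable φ := measurable_fst.coe_nnreal_ennreal.mul (measurable_one.indicator hD)
  have h1 : tiltedProb P W A K = ∫⁻ q, φ q ∂((P.map fun ω => pathSup (W ω)) ⊗ₘ
      condDistrib W (fun ω => pathSup (W ω)) P) := by
    rw [Measure.lintegral_compProd hφ]
    refine lintegral_congr fun y => ?_
    have hDy : MeasurableSet {f | centredPath y f ∈ A ∧ firstArgmax f ∈ K} :=
      measurable_prodMk_left hD
    rw [← lintegral_indicator_one hDy,
      ← lintegral_const_mul _ (measurable_one.indicator hDy)]
    rfl
  rw [h1, compProd_map_condDistrib hW.aemeasurable, lintegral_map hφ (hγ.prodMk hW),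
    profileMeasure_apply _ (hK.prod hA), lintegral_map _ hW]
  · refine lintegral_congr fun ω => ?_
    change (pathSup (W ω) : ℝ≥0∞) * D.indicator 1 (pathSup (W ω), W ω) = _
    congr 1
    by_cases h : centredPath (pathSup (W ω)) (W ω) ∈ A ∧ firstArgmax (W ω) ∈ K
    · rw [Set.indicator_of_mem (show (pathSup (W ω), W ω) ∈ D from h),
        Set.indicator_of_mem (Set.mk_mem_prod h.2 h.1)]
      rfl
    · rw [Set.indicator_of_notMem (show (pathSup (W ω), W ω) ∉ D from h),
        Set.indicator_of_notMem fun h' => h ⟨h'.2, h'.1⟩]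
  · exact measurable_coe_pathSup.mul
      ((measurable_one.indicator (hK.prod hA)).comp measurable_profile)

/-! ### From point processes to max-stable processes. -/

lemma sum_dirac_apply_eq_zero_iff {S : Type*} [MeasurableSpace S] (x : ℕ → S) {B : Set S}
    (hB : MeasurableSet B) :
    (Measure.sum fun i => Measure.dirac (x i)) B = 0 ↔ ∀ i, x i ∉ B := by
  rw [Measure.sum_apply _ hB, ENNReal.tsum_eq_zero]
  refine forall_congr' fun i => ?_
  rw [Measure.dirac_apply' _ hB]
  by_cases h : x i ∈ B <;> simp [h]

lemma centredPointProcess_eq {Ω : Type*} (U : ℕ → Ω → ℝ) (W : ℕ → Ω → PathSpace d) (ω : Ω) :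
    centredPointProcess U W ω =
      ((Measure.sum fun i => Measure.dirac (U i ω, W i ω)).map centredMap).restrict
        {q | 0 < q.1} := by
  rw [Measure.map_sum measurable_centredMap.aemeasurable]
  simp_rw [Measure.map_dirac' measurable_centredMap]
  rfl

section

variable {Ω : Type*} [MeasurableSpace Ω] {P : Measure Ω} {U : ℕ → Ω → ℝ} {W : ℕ → Ω → PathSpace d}

/-- The finite-dimensional distributions of a max-stable process. -/
lemma measure_maxProcess_le [IsProbabilityMeasure P] {p : Measure (PathSpace d)} [SFinite p]
    (hN : IsPoissonPointProcess P (fun ω => Measure.sum fun i => Measure.dirac (U i ω, W i ω))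
      (frechetIntensity.prod p))
    {n : ℕ} (t : Fin n → EuclideanSpace ℝ (Fin d)) (x : Fin n → ℝ≥0) :
    P {ω | ∀ j, maxProcess U W (t j) ω ≤ x j} =
      expNeg (exponentMeasure p {f | ∃ j, x j < f (t j)}) := by
  have hE : MeasurableSet {f : PathSpace d | ∃ j, x j < f (t j)} := by
    simp only [Set.ofPred_exists]
    exact MeasurableSet.iUnion fun j => measurableSet_lt measurable_const (measurable_pathEval _)
  rw [exponentMeasure, Measure.map_apply measurable_smulPath hE,
    ← hN.measure_apply_eq_zero (measurable_smulPath hE)]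
  congr 1
  ext ω
  simp only [Set.mem_ofPred_eq]
  -- The process stays below the levels `x j` at the points `t j` exactly when no point `(u, f)` has
  -- `u f` in the exceedance set, which is a void event.
  rw [sum_dirac_apply_eq_zero_iff _ (measurable_smulPath hE)]
  simp only [Set.mem_preimage, Set.mem_ofPred_eq, not_exists, not_lt, maxProcess, iSup_le_iff]
  rw [forall_comm]
  refine forall₂_congr fun i j => ?_
  rw [ContinuousMap.smul_apply, smul_eq_mul, ENNReal.ofReal, ← ENNReal.coe_mul, ENNReal.coe_le_coe]

lemma measurable_maxProcess (hU : ∀ i, Measurable (U i)) (hW : ∀ i, Measurable (W i))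
    (t : EuclideanSpace ℝ (Fin d)) : Measurable (maxProcess U W t) :=
  Measurable.iSup fun i => (hU i).ennreal_ofReal.mul
    ((measurable_pathEval t).comp (hW i)).coe_nnreal_ennreal

/-- Brown–Resnick stationarity amounts to shift invariance of the exponent measure. -/
lemma exponentMeasure_shift_eq [IsProbabilityMeasure P] {p : Measure (PathSpace d)}
    [IsProbabilityMeasure p]
    (hU : ∀ i, Measurable (U i)) (hW : ∀ i, Measurable (W i))
    (hN : IsPoissonPointProcess P (fun ω => Measure.sum fun i => Measure.dirac (U i ω, W i ω))
      (frechetIntensity.prod p))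
    (hmean : ∀ t, ∫⁻ f, (f t : ℝ≥0∞) ∂p = 1) (hstat : IsStationaryField P (maxProcess U W))
    (h : EuclideanSpace ℝ (Fin d)) :
    (exponentMeasure p).restrict {f | f ≠ 0} =
      ((exponentMeasure p).map (shiftPath h)).restrict {f | f ≠ 0} := by
  refine restrict_eq_of_exceedance (fun t x hx => ?_) fun n t x _ => ?_
  · rw [exponentMeasure_exceed p t hx, hmean]
    exact ENNReal.div_ne_top ENNReal.one_ne_top (by simpa using hx.ne')
  · have hE : MeasurableSet {f : PathSpace d | ∃ j, x j < f (t j)} := by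
      simp only [Set.ofPred_exists]
      exact MeasurableSet.iUnion fun j => measurableSet_lt measurable_const (measurable_pathEval _)
    rw [Measure.map_apply (measurable_shiftPath h) hE]
    have hB : MeasurableSet {y : Fin n → ℝ≥0∞ | ∀ j, y j ≤ x j} := by
      simp only [Set.ofPred_forall]
      exact MeasurableSet.iInter fun j => measurableSet_le (measurable_pi_apply j) measurable_const
    have hm : ∀ s : Fin n → EuclideanSpace ℝ (Fin d),
        Measurable fun ω j => maxProcess U W (s j) ω := fun s =>
      measurable_pi_lambda _ fun j => measurable_maxProcess hU hW _
    have h1 := congrArg (fun μ => μ {y : Fin n → ℝ≥0∞ | ∀ j, y j ≤ x j}) (hstat h n t)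
    rw [Measure.map_apply (hm fun j => t j + h) hB, Measure.map_apply (hm t) hB] at h1
    have h2 := measure_maxProcess_le hN t x
    have h3 := measure_maxProcess_le hN (fun j => t j + h) x
    -- Injectivity of `expNeg` lifts the equality of probabilities to equality of exponents.
    rw [← negLog_expNeg (exponentMeasure p {f | ∃ j, x j < f (t j)}), ← h2]
    change negLog (P ((fun ω j => maxProcess U W (t j) ω) ⁻¹' {y | ∀ j, y j ≤ x j})) = _
    rw [← h1]
    change negLog (P {ω | ∀ j, maxProcess U W (t j + h) ω ≤ x j}) = _
    rw [h3, negLog_expNeg]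
    rfl

end

/-! ### Rescaling to unit intensity -/

/-- The map `(u, s, f) ↦ (u / c, s, c f)`. -/
noncomputable def rescaleMap (c : ℝ≥0) :
    ℝ × EuclideanSpace ℝ (Fin d) × PathSpace d → ℝ × EuclideanSpace ℝ (Fin d) × PathSpace d :=
  Prod.map (fun u => (c : ℝ)⁻¹ * u) (Prod.map id fun f => c • f)

lemma measurable_const_smulPath (c : ℝ≥0) : Measurable fun f : PathSpace d => c • f :=
  (continuous_smulPath.comp (continuous_const.prodMk continuous_id)).measurable

lemma measurable_rescaleMap (c : ℝ≥0) : Measurable (rescaleMap (d := d) c) :=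
  (measurable_id.const_mul _).prodMap (measurable_id.prodMap (measurable_const_smulPath c))

lemma map_frechetIntensity_mul {a : ℝ} (ha : 0 < a) :
    frechetIntensity.map (fun u => a * u) = ENNReal.ofReal a • frechetIntensity := by
  ext A hA
  rw [Measure.map_apply (by fun_prop) hA, frechetIntensity_preimage_mul ha hA, Measure.smul_apply,
    smul_eq_mul]

/-- Dilating heights by `1/c` divides the Fréchet intensity by `c`, cancelling the prefactor; the
factor `c` reappears in the shape function. -/
lemma map_rescaleMap_m3Intensity {c : ℝ≥0} (hc : 0 < c) (Q : Measure (PathSpace d))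
    [IsProbabilityMeasure Q] :
    (m3Intensity c Q).map (rescaleMap c) = m3Intensity 1 (Q.map fun f => c • f) := by
  have hcs := measurable_const_smulPath (d := d) c
  have := Measure.isProbabilityMeasure_map (μ := Q) hcs.aemeasurable
  have hc' : (0 : ℝ) < (c : ℝ)⁻¹ := inv_pos.2 (by exact_mod_cast hc)
  have hinv : ENNReal.ofReal (c : ℝ)⁻¹ = (c : ℝ≥0∞)⁻¹ := by
    rw [ENNReal.ofReal_inv_of_pos (by exact_mod_cast hc), ENNReal.ofReal_coe_nnreal]
  rw [m3Intensity, m3Intensity, Measure.map_smul, rescaleMap,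
    ← Measure.map_prod_map _ _ (by fun_prop) (measurable_id.prodMap hcs),
    ← Measure.map_prod_map _ _ measurable_id hcs, Measure.map_id, map_frechetIntensity_mul hc',
    Measure.prod_smul_left, smul_smul, hinv, ENNReal.mul_inv_cancel (by simpa using hc.ne')
    ENNReal.coe_ne_top, ENNReal.coe_one]

lemma lintegral_map_smulPath (c : ℝ≥0) (Q : Measure (PathSpace d)) :
    ∫⁻ f, ∫⁻ t, (f t : ℝ≥0∞) ∂(volume : Measure (EuclideanSpace ℝ (Fin d)))
      ∂(Q.map fun f => c • f) =
      c * ∫⁻ f, ∫⁻ t, (f t : ℝ≥0∞) ∂(volume : Measure (EuclideanSpace ℝ (Fin d))) ∂Q := by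
  have hm : Measurable fun f : PathSpace d =>
      ∫⁻ t, (f t : ℝ≥0∞) ∂(volume : Measure (EuclideanSpace ℝ (Fin d))) :=
    measurable_uncurry_path.lintegral_prod_right'
  rw [lintegral_map hm (measurable_const_smulPath c), ← lintegral_const_mul _ hm]
  refine lintegral_congr fun f => ?_
  rw [← lintegral_const_mul' _ _ ENNReal.coe_ne_top]
  refine lintegral_congr fun t => ?_
  rw [← ENNReal.coe_mul]
  rfl

/-- The points of the rescaled centred process reproduce the max-stable process. -/
lemma maxProcess_eq_biSup {Ω : Type*} {U : ℕ → Ω → ℝ} {W : ℕ → Ω → PathSpace d}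
    {c : ℝ≥0} (hc : 0 < c) {ω : Ω} (hU : ∀ i, 0 < U i ω) (hV : ∀ i, W i ω ∈ vanishingPaths d)
    (t : EuclideanSpace ℝ (Fin d)) :
    maxProcess U W t ω =
      ⨆ q ∈ {q : ℝ × EuclideanSpace ℝ (Fin d) × PathSpace d |
          ((centredPointProcess U W ω).map (rescaleMap c)) {q} ≠ 0},
        ENNReal.ofReal q.1 * (q.2.2 (t - q.2.1) : ℝ≥0∞) := by
  have hpos : MeasurableSet {q : ℝ × EuclideanSpace ℝ (Fin d) × PathSpace d | 0 < q.1} :=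
    measurableSet_lt measurable_const measurable_fst
  -- The atoms are the images of the indices with positive supremum; distinct indices may share an
  -- atom, which does not affect a supremum.
  have hmem : ∀ q, ((centredPointProcess U W ω).map (rescaleMap c)) {q} ≠ 0 ↔
      ∃ i, 0 < pathSup (W i ω) ∧ rescaleMap c (centredMap (U i ω, W i ω)) = q := by
    intro q
    have hS : MeasurableSet ((rescaleMap (d := d) c) ⁻¹' {q}) :=
      measurable_rescaleMap c (measurableSet_singleton q)
    rw [Measure.map_apply (measurable_rescaleMap c) (measurableSet_singleton q),
      centredPointProcess, Measure.restrict_apply hS, Ne,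
      sum_dirac_apply_eq_zero_iff _ (hS.inter hpos)]
    push Not
    refine exists_congr fun i => ?_
    rw [Set.mem_inter_iff, and_comm]
    refine and_congr ?_ Iff.rfl
    change 0 < U i ω * (pathSup (W i ω) : ℝ) ↔ _
    rw [mul_pos_iff_of_pos_left (hU i), NNReal.coe_pos]
  have hval : ∀ i, 0 < pathSup (W i ω) →
      ENNReal.ofReal (rescaleMap c (centredMap (U i ω, W i ω))).1 *
        ((rescaleMap c (centredMap (U i ω, W i ω))).2.2
          (t - (rescaleMap c (centredMap (U i ω, W i ω))).2.1) : ℝ≥0∞) =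
      ENNReal.ofReal (U i ω) * (W i ω t : ℝ≥0∞) := by
    intro i _
    change ENNReal.ofReal ((c : ℝ)⁻¹ * (U i ω * pathSup (W i ω))) *
      ((c * centredPath (pathSup (W i ω)) (W i ω) (t - firstArgmax (W i ω)) : ℝ≥0) : ℝ≥0∞) = _
    rw [← pathSup_mul_centredPath (hV i) t, ENNReal.ofReal, ENNReal.ofReal, ← ENNReal.coe_mul,
      ← ENNReal.coe_mul, Real.toNNReal_mul (by positivity), Real.toNNReal_mul (hU i).le,
      Real.toNNReal_coe, Real.toNNReal_inv, Real.toNNReal_coe]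
    congr 1
    field_simp
  refine le_antisymm (iSup_le fun i => ?_) (iSup₂_le fun q hq => ?_)
  -- An index without a point has `W i ω` identically zero and contributes `0` to the maximum.
  · rcases eq_or_ne (pathSup (W i ω)) 0 with h0 | h0
    · have : W i ω t = 0 := by rw [← pathSup_mul_centredPath (hV i) t, h0, zero_mul]
      simp [this]
    · have h0' := pos_iff_ne_zero.2 h0
      rw [← hval i h0']
      exact le_iSup₂ (f := fun (q : ℝ × EuclideanSpace ℝ (Fin d) × PathSpace d)
        (_ : q ∈ {q | ((centredPointProcess U W ω).map (rescaleMap c)) {q} ≠ 0}) =>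
        ENNReal.ofReal q.1 * (q.2.2 (t - q.2.1) : ℝ≥0∞)) _ ((hmem _).2 ⟨i, h0', rfl⟩)
  · obtain ⟨i, hi, rfl⟩ := (hmem q).1 hq
    rw [hval i hi]
    exact le_iSup (fun i => ENNReal.ofReal (U i ω) * (W i ω t : ℝ≥0∞)) i

end

/-! ### Assembly of the main theorem. -/

theorem mainTheorem4 {d : ℕ} {Ω Ω₀ : Type*} [MeasurableSpace Ω] [MeasurableSpace Ω₀]
    (P : Measure Ω) [IsProbabilityMeasure P] (P₀ : Measure Ω₀) [IsProbabilityMeasure P₀]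
    -- the Fréchet point process, and independent copies `W i` of `W₀`, independent of it
    (U : ℕ → Ω → ℝ) (W : ℕ → Ω → PathSpace d) (W₀ : Ω₀ → PathSpace d)
    (hU_meas : ∀ i, Measurable (U i)) (hW_meas : ∀ i, Measurable (W i))
    (hW₀_meas : Measurable W₀)
    (hU : IsFrechetPointProcess P U)
    (hW_copy : ∀ i, IdentDistrib (W i) W₀ P P₀)
    (hW_indep : iIndepFun W P)
    (hUW_indep : IndepFun (fun ω i => U i ω) (fun ω i => W i ω) P)
    -- the assumptions on the process `W₀`
    (h_vanish : ∀ᵐ ω ∂P₀,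
      Filter.Tendsto (W₀ ω) (Bornology.cobounded (EuclideanSpace ℝ (Fin d))) (𝓝 0))
    (h_mean : ∀ t, ∫⁻ ω, (W₀ ω t : ℝ≥0∞) ∂P₀ = 1)
    (h_max : ∀ K : Set (EuclideanSpace ℝ (Fin d)), IsCompact K →
      ∫⁻ ω, ⨆ t ∈ K, (W₀ ω t : ℝ≥0∞) ∂P₀ < ∞)
    -- Brown-Resnick stationarity
    (h_stat : IsStationaryField P (maxProcess U W))
    (h_margins : HasStandardFrechetMargins P (maxProcess U W)) :
    -- `γ_i` and `τ_i` are well-defined random variables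
    (∀ i, AEMeasurable (fun ω => pathSup (W i ω)) P ∧
      AEMeasurable (fun ω => firstArgmax (W i ω)) P ∧
      ∀ᵐ ω ∂P, BddAbove (Set.range (W i ω)) ∧
        (0 < pathSup (W i ω) → ∃! t, IsFirstArgmax (W i ω) t)) ∧
    ∃ (c : ℝ≥0) (Q : Measure (PathSpace d)), 0 < c ∧ IsProbabilityMeasure Q ∧
      -- the Poisson property, with `Q` the law of the normalised shape function
      IsPoissonPointProcess P (centredPointProcess U W) (m3Intensity c Q) ∧
      -- the M3 representation, with shape function `c` times a function distributed as `Q`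
      HasM3Representation P (maxProcess U W) (Q.map fun f => c • f) ∧
      -- the explicit forms of `c` and `Q`
      (c : ℝ≥0∞) =
        (∫⁻ t : EuclideanSpace ℝ (Fin d), ∫⁻ f, (f t : ℝ≥0∞) ∂Q)⁻¹ ∧
      ∀ A : Set (PathSpace d), MeasurableSet A →
        ∀ K : Set (EuclideanSpace ℝ (Fin d)), IsCompact K → 0 < volume K →
          0 < tiltedProb P₀ W₀ Set.univ K ∧ tiltedProb P₀ W₀ Set.univ K < ∞ ∧
          Q A = tiltedProb P₀ W₀ A K / tiltedProb P₀ W₀ Set.univ K := by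
  set p := P₀.map W₀ with hp
  have hpP : IsProbabilityMeasure p := Measure.isProbabilityMeasure_map hW₀_meas.aemeasurable
  have hlaw : ∀ i, P.map (W i) = p := fun i => (hW_copy i).map_eq
  have hV : ∀ᵐ f ∂p, f ∈ vanishingPaths d :=
    (ae_map_iff hW₀_meas.aemeasurable measurableSet_vanishingPaths).2 h_vanish
  have hVW : ∀ i, ∀ᵐ ω ∂P, W i ω ∈ vanishingPaths d := fun i => by
    rw [← hlaw i] at hV
    exact ae_of_ae_map (hW_meas i).aemeasurable hV
  have hmean : ∀ t, ∫⁻ f, (f t : ℝ≥0∞) ∂p = 1 := fun t => by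
    rw [hp, lintegral_map (measurable_pathEval t).coe_nnreal_ennreal hW₀_meas]
    exact h_mean t
  have hmax : ∀ K : Set (EuclideanSpace ℝ (Fin d)), IsCompact K →
      ∫⁻ f, ⨆ t ∈ K, (f t : ℝ≥0∞) ∂p < ∞ := fun K hK => by
    rw [hp, lintegral_map (measurable_biSup_path K) hW₀_meas]
    exact h_max K hK
  have hN : IsPoissonPointProcess P (fun ω => Measure.sum fun i => Measure.dirac (U i ω, W i ω))
      (frechetIntensity.prod p) :=
    IsPoissonPointProcess.marking hU hU_meas hW_meas hlaw hW_indep hUW_indep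
  obtain ⟨c, Q, hc, hQ, hprof, hcI⟩ := exists_shape_law hV hmean hmax
    (exponentMeasure_shift_eq hU_meas hW_meas hN hmean h_stat)
  have hpos : MeasurableSet {q : ℝ × EuclideanSpace ℝ (Fin d) × PathSpace d | 0 < q.1} :=
    measurableSet_lt measurable_const measurable_fst
  have hcentred : IsPoissonPointProcess P (centredPointProcess U W) (m3Intensity c Q) := by
    have h := (hN.map measurable_centredMap).restrict hpos
    rw [map_centredMap_restrict, hprof, Measure.prod_smul_right] at h
    simp_rw [← centredPointProcess_eq] at h
    exact h
  have hc0 : (c : ℝ≥0∞) ≠ 0 := by simpa using hc.ne'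
  refine ⟨fun i => ⟨(measurable_pathSup.comp (hW_meas i)).aemeasurable,
    (measurable_firstArgmax.comp (hW_meas i)).aemeasurable, ?_⟩,
    c, Q, hc, hQ, hcentred, ⟨?_, ?_, ?_⟩, ?_, ?_⟩
  · filter_upwards [hVW i] with ω hω
    refine ⟨bddAbove_of_mem_vanishingPaths hω, fun h0 => ?_⟩
    obtain ⟨t, ht⟩ := exists_isFirstArgmax hω h0
    exact ⟨t, ht, fun s hs => hs.unique ht⟩
  · exact Measure.isProbabilityMeasure_map (measurable_const_smulPath c).aemeasurable
  · rw [lintegral_map_smulPath, hcI]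
  · refine ⟨fun ω => (centredPointProcess U W ω).map (rescaleMap c), ?_, ?_⟩
    · rw [← map_rescaleMap_m3Intensity hc]
      exact hcentred.map (measurable_rescaleMap c)
    -- The intensity does not charge `(-∞, 0]`, so the void probability of that half-line is `1`.
    · have hUpos : ∀ᵐ ω ∂P, ∀ i, 0 < U i ω := by
        have h0 := hU.measure_apply_eq_zero (measurableSet_Iic (a := (0 : ℝ)))
        rw [frechetIntensity_Iic_zero, expNeg_zero] at h0
        have hm : NullMeasurableSet
            {ω | (Measure.sum fun i => Measure.dirac (U i ω)) (Set.Iic (0 : ℝ)) = 0} P :=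
          (hU.aemeasurable _ measurableSet_Iic).nullMeasurable (measurableSet_singleton 0)
        filter_upwards [(prob_compl_eq_zero_iff₀ hm).2 h0] with ω hω i
        have := (sum_dirac_apply_eq_zero_iff _ measurableSet_Iic).1 hω i
        exact not_le.1 this
      filter_upwards [hUpos, ae_all_iff.2 hVW] with ω h1 h2 t
      exact maxProcess_eq_biSup hc h1 h2 t
  · have hswap : ∫⁻ t : EuclideanSpace ℝ (Fin d), ∫⁻ f, (f t : ℝ≥0∞) ∂Q =
        ∫⁻ f, ∫⁻ t, (f t : ℝ≥0∞) ∂(volume : Measure (EuclideanSpace ℝ (Fin d))) ∂Q :=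
      lintegral_lintegral_swap (measurable_uncurry_path.comp measurable_swap).aemeasurable
    rw [hswap]
    exact ENNReal.eq_inv_of_mul_eq_one_left hcI
  · intro A hA K hK hKpos
    have hKtop : volume K ≠ ∞ := hK.measure_lt_top.ne
    -- The factor `c |K|` is common to numerator and denominator, and is positive and finite, so the
    -- quotient does not depend on `K`.
    have htilt : ∀ A : Set (PathSpace d), MeasurableSet A →
        tiltedProb P₀ W₀ A K = c * (volume K * Q A) := fun A hA => by
      rw [tiltedProb_eq_profileMeasure P₀ hW₀_meas hA hK.measurableSet, ← hp, hprof,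
        Measure.smul_apply, Measure.prod_prod, smul_eq_mul]
    rw [htilt _ MeasurableSet.univ, htilt A hA, measure_univ, mul_one]
    refine ⟨ENNReal.mul_pos hc0 hKpos.ne', ENNReal.mul_lt_top ENNReal.coe_lt_top hKtop.lt_top, ?_⟩
    rw [← mul_assoc, mul_comm (c * volume K), mul_div_assoc, ENNReal.div_self
      (mul_ne_zero hc0 hKpos.ne') (ENNReal.mul_ne_top ENNReal.coe_ne_top hKtop), mul_one]
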